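/- In hyperbolic 3-space $\mathbb{H}^3$ (of curvature $-1$) there exist a nonconvex polyhedron $P$ homeomorphic to the 2-sphere (a compact boundary-free polyhedral surface composed of finitely many geodesic triangles, which does not bound a convex body) and a continuous family $(P_t)_{t\in[0,1]}$ of polyhedra of the same combinatorial type, with $P_0=P$ and with vertices depending continuously on $t$, such that every $P_t$ is again nonconvex and homeomorphic to the sphere, and: (i) $P$, and likewise every $P_t$, has no self-intersections; (ii) the deformation is nontrivial, i.e. for $t\neq 0$ no isometry of $\mathbb{H}^3$ carries the vertices of $P_0$ to the corresponding vertices of $P_t$, and it leaves fixed all dihedral angles (measured inside the bounded domain; the dihedral angle at an edge between two coplanar adjacent triangles is $\pi$); (iii) the surface area of $P_t$ is a nonconstant function of $t$; (iv) the total mean curvature $\frac12\sum_{\ell}(\pi-\alpha(\ell))\,|\ell|$ of $P_t$, where the sum is over all edges $\ell$, $\alpha(\ell)$ is the dihedral angle at $\ell$ and $|\ell|$ is the length of $\ell$, is a nonconstant function of $t$; (v) for some vertex, the Gauss curvature of $P_t$ at this vertex, i.e. $2\pi$ minus the sum of all plane angles incident to it, is a nonconstant function of $t$. -/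

import Mathlib

noncomputable section

namespace HypPoly

/-! ### Hyperbolic 3-space (hyperboloid model, curvature `-1`) -/

/-- The Lorentz form `-x₀y₀ + x₁y₁ + x₂y₂ + x₃y₃` on `ℝ⁴`. -/
def lor (x y : Fin 4 → ℝ) : ℝ := -(x 0 * y 0) + x 1 * y 1 + x 2 * y 2 + x 3 * y 3

/-- Hyperbolic 3-space: the upper sheet of the hyperboloid `⟨x, x⟩ = -1`,
with the topology induced from `ℝ⁴`. -/
abbrev H3 : Type := {x : Fin 4 → ℝ // lor x x = -1 ∧ 0 < x 0}

/-- The hyperbolic distance. -/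
def hdist (x y : H3) : ℝ := Real.arcosh (-lor x.1 y.1)

/-- A rigid motion of the whole space (it may reverse the orientation). -/
def IsRigidMotion (φ : H3 ≃ H3) : Prop := ∀ x y, hdist (φ x) (φ y) = hdist x y

/-- The geodesic segment with end-points `x` and `y`: geodesics of the hyperboloid model are cut
out by linear planes. -/
def geodSegment (x y : H3) : Set H3 :=
  {z | ∃ a b : ℝ, 0 ≤ a ∧ 0 ≤ b ∧ z.1 = a • x.1 + b • y.1}

/-- Geodesic convexity. -/
def GeodConvex (C : Set H3) : Prop := ∀ x ∈ C, ∀ y ∈ C, geodSegment x y ⊆ C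

/-- The sign of `det4 u v w q` tells on which side of the oriented plane through `u, v, w`
the point `q` lies. -/
def det4 (u v w q : H3) : ℝ := Matrix.det ![u.1, v.1, w.1, q.1]

/-! ### Angles and areas -/

/-- The angle between two spacelike vectors of a positive definite subspace. -/
def lorAngle (x y : Fin 4 → ℝ) : ℝ :=
  Real.arccos (lor x y / (Real.sqrt (lor x x) * Real.sqrt (lor y y)))

/-- The initial direction at `u` of the geodesic from `u` to `v`: the Lorentz-orthogonal projection
of `v` to the tangent space `u^⊥`. -/
def dirTo (u v : H3) : Fin 4 → ℝ := v.1 + lor u.1 v.1 • u.1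

/-- The plane angle at `u` of the geodesic triangle `u v w`. -/
def planeAngle (u v w : H3) : ℝ := lorAngle (dirTo u v) (dirTo u w)

/-- The Lorentz-orthogonal projection of `w` to the normal plane `span(u, v)^⊥` of the
geodesic line through `u ≠ v`. It is the direction, orthogonal to the edge `u v`, which points
into the half-plane bounded by the line `u v` and containing `w`. -/
def edgePerp (u v w : H3) : Fin 4 → ℝ :=
  w.1 - (1 / (lor u.1 v.1 ^ 2 - 1)) •
    ((lor w.1 u.1 + lor u.1 v.1 * lor w.1 v.1) • u.1 +
      (lor w.1 v.1 + lor u.1 v.1 * lor w.1 u.1) • v.1)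

open Classical in
/-- The dihedral angle, in `[0, 2π]`, at the edge `u v` between the oriented faces `(u, v, w)` and
`(v, u, w')`, measured on the side that near the face `(u, v, w)` is `det4 u v w q < 0`.
The angle is at most `π` exactly if `w'` lies on this side or on the plane `u v w`. -/
def dihedralAngle (u v w w' : H3) : ℝ :=
  if det4 u v w w' ≤ 0 then lorAngle (edgePerp u v w) (edgePerp u v w')
  else 2 * Real.pi - lorAngle (edgePerp u v w) (edgePerp u v w')

/-- The hyperbolic metric in homogeneous coordinates: the value at the tangent vectors `ξ, η` to
`ℝ⁴` at the timelike point `y` of the pull-back of the Riemannian metric of the hyperboloid under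
the central projection `y ↦ y / √(-⟨y, y⟩)`. -/
def projMetric (y ξ η : Fin 4 → ℝ) : ℝ :=
  lor ξ η / (-lor y y) + lor ξ y * lor η y / (lor y y) ^ 2

/-- The hyperbolic (Riemannian) area of the geodesic triangle `u v w`, which is parametrized by
central projection of `u + s (v - u) + t (w - u)`, where `s, t ≥ 0` and `s + t ≤ 1`. -/
def triArea (u v w : H3) : ℝ :=
  ∫ z in {z : ℝ × ℝ | 0 ≤ z.1 ∧ 0 ≤ z.2 ∧ z.1 + z.2 ≤ 1},
    Real.sqrt
      (projMetric (u.1 + z.1 • (v.1 - u.1) + z.2 • (w.1 - u.1)) (v.1 - u.1) (v.1 - u.1) *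
        projMetric (u.1 + z.1 • (v.1 - u.1) + z.2 • (w.1 - u.1)) (w.1 - u.1) (w.1 - u.1) -
        projMetric (u.1 + z.1 • (v.1 - u.1) + z.2 • (w.1 - u.1)) (v.1 - u.1) (w.1 - u.1) ^ 2)

/-- Six times the Euclidean volume of the oriented tetrahedron spanned by the origin and
the images of `u, v, w` in the projective (Beltrami-Klein) ball model. -/
def kleinDet (u v w : H3) : ℝ :=
  Matrix.det ![![u.1 1 / u.1 0, u.1 2 / u.1 0, u.1 3 / u.1 0],
    ![v.1 1 / v.1 0, v.1 2 / v.1 0, v.1 3 / v.1 0],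
    ![w.1 1 / w.1 0, w.1 2 / w.1 0, w.1 3 / w.1 0]]

/-! ### Oriented closed triangulations -/

/-- The combinatorial data of a closed (boundary-free) oriented triangulated surface with the
vertices `0, …, n - 1`. An oriented triangle is listed with all three of its cyclic rotations.
Every edge belongs to exactly two triangles, which induce opposite directions on it. -/
structure OrientedTriangulation (n : ℕ) where
  faces : Finset (Fin n × Fin n × Fin n)
  ne_of_mem : ∀ a b c, (a, b, c) ∈ faces → a ≠ b
  rotate_mem : ∀ a b c, (a, b, c) ∈ faces → (b, c, a) ∈ faces
  unique_third : ∀ a b c d, (a, b, c) ∈ faces → (a, b, d) ∈ faces → c = d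
  exists_opposite : ∀ a b c, (a, b, c) ∈ faces → ∃ d, (b, a, d) ∈ faces
  exists_face : ∀ a, ∃ b c, (a, b, c) ∈ faces

namespace OrientedTriangulation

variable {n : ℕ}

/-- Every oriented face once: the rotation that starts with the least vertex. -/
def facesOnce (K : OrientedTriangulation n) : Finset (Fin n × Fin n × Fin n) :=
  K.faces.filter fun f => f.1 < f.2.1 ∧ f.1 < f.2.2

/-- `(a, b, c, d)` is a hinge if `a b` is an edge with the adjacent oriented faces `(a, b, c)` and
`(b, a, d)`. -/
def IsHinge (K : OrientedTriangulation n) (a b c d : Fin n) : Prop :=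
  (a, b, c) ∈ K.faces ∧ (b, a, d) ∈ K.faces

open Classical in
/-- Every edge once, as a hinge with `a < b`. -/
def hingesOnce (K : OrientedTriangulation n) : Finset (Fin n × Fin n × Fin n × Fin n) :=
  Finset.univ.filter fun h => h.1 < h.2.1 ∧ K.IsHinge h.1 h.2.1 h.2.2.1 h.2.2.2

end OrientedTriangulation

/-! ### Polyhedra: realizations of triangulations in hyperbolic 3-space -/

section Polyhedra

variable {n : ℕ}

/-- The hyperbolic convex hull of the points `p i`, `i ∈ s`. -/
def simplexHull (p : Fin n → H3) (s : Finset (Fin n)) : Set H3 :=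
  {x | ∃ c : Fin n → ℝ, (∀ i ∈ s, 0 ≤ c i) ∧ x.1 = ∑ i ∈ s, c i • (p i).1}

/-- The set of vertices of a face. -/
def faceVerts (f : Fin n × Fin n × Fin n) : Finset (Fin n) := {f.1, f.2.1, f.2.2}

/-- The polyhedral surface as a set of points: the union of its (geodesic) triangles. -/
def surface (K : OrientedTriangulation n) (p : Fin n → H3) : Set H3 :=
  ⋃ f ∈ K.faces, simplexHull p (faceVerts f)

/-- The polyhedron has nondegenerate triangles, and no self-intersections: two of its triangles
meet exactly in the hull of their common vertices. -/
def NoSelfIntersections (K : OrientedTriangulation n) (p : Fin n → H3) : Prop :=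
  (∀ a b c, (a, b, c) ∈ K.faces → LinearIndependent ℝ ![(p a).1, (p b).1, (p c).1]) ∧
  ∀ f ∈ K.faces, ∀ g ∈ K.faces,
    simplexHull p (faceVerts f) ∩ simplexHull p (faceVerts g) =
      simplexHull p (faceVerts f ∩ faceVerts g)

/-- The faces are oriented counterclockwise as seen from outside, i.e. the enclosed domain lies near
a face `(a, b, c)` on the side `det4 < 0`: the volume of this domain (in the projective
ball model), as computed by the divergence theorem from the orientation, is positive. -/
def OutwardOriented (K : OrientedTriangulation n) (p : Fin n → H3) : Prop :=
  0 < ∑ f ∈ K.facesOnce, kleinDet (p f.1) (p f.2.1) (p f.2.2)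

/-- The surface is homeomorphic to the 2-sphere. -/
def SphereHomeomorphic (K : OrientedTriangulation n) (p : Fin n → H3) : Prop :=
  Nonempty (surface K p ≃ₜ Metric.sphere (0 : EuclideanSpace ℝ (Fin 3)) 1)

/-- The surface is convex: it bounds a compact convex body. -/
def ConvexSurface (K : OrientedTriangulation n) (p : Fin n → H3) : Prop :=
  ∃ C : Set H3, GeodConvex C ∧ IsCompact C ∧ frontier C = surface K p

/-- The surface area. -/
def surfaceArea (K : OrientedTriangulation n) (p : Fin n → H3) : ℝ :=
  ∑ f ∈ K.facesOnce, triArea (p f.1) (p f.2.1) (p f.2.2)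

/-- The total mean curvature: half of the sum of `(π - α(ℓ)) |ℓ|` over all edges `ℓ`. -/
def totalMeanCurvature (K : OrientedTriangulation n) (p : Fin n → H3) : ℝ :=
  (1 / 2) * ∑ h ∈ K.hingesOnce,
    (Real.pi - dihedralAngle (p h.1) (p h.2.1) (p h.2.2.1) (p h.2.2.2)) * hdist (p h.1) (p h.2.1)

/-- The Gauss curvature of the vertex `v`: `2π` minus the sum of all plane angles at `v`. -/
def gaussCurvature (K : OrientedTriangulation n) (p : Fin n → H3) (v : Fin n) : ℝ :=
  2 * Real.pi - ∑ f ∈ K.faces.filter (fun f => f.1 = v), planeAngle (p v) (p f.2.1) (p f.2.2)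

/-- Two realizations that differ by a rigid motion of the whole space. -/
def Congruent (p q : Fin n → H3) : Prop :=
  ∃ φ : H3 ≃ H3, IsRigidMotion φ ∧ ∀ v, φ (p v) = q v

/-- A polyhedron: without self-intersections, homeomorphic to the sphere, its faces being oriented
so that dihedral angles are measured inside the enclosed domain. -/
structure IsEmbeddedSphere (K : OrientedTriangulation n) (p : Fin n → H3) : Prop where
  noSelfIntersections : NoSelfIntersections K p
  sphereHomeomorphic : SphereHomeomorphic K p
  outwardOriented : OutwardOriented K p

end Polyhedra

end HypPoly

end

/-!
Let `T` be a tetrahedron with a base in the plane `x₃ = 0`, and let `T'` be its image under the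
half-turn about the `x₁`-axis, which lies on the other side of this plane. If the two bases overlap,
then the boundary of the body `T ∪ T'` is a nonconvex sphere, and the body may be deformed by
rotating `T` and `T'` about the `x₃`-axis by the angles `β` and `-β`. The dihedral angles remain
constant: an edge of `T` outside the base of `T'` keeps the dihedral angle `δ` which it has in `T`;
a part of an edge of `T` in the interior of the base of `T'` has the angle `π + δ`; all other edges
of a triangulation subdivide a plane face and have the angle `π`. But the overlap of the bases
changes, and with it the area (twice the area of the overlap is missing), the lengths of edges and
the plane angles.

Concretely, the vertex `0` is the point where the `x₃`-axis meets the plane `x₃ = 0`; it is a common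
vertex of `T` (with the base `0 2 4` and the apex `3`) and of `T'` (with the base `0 5 7` and
the apex `6`). The overlap is the quadrangle `0 4 1 7`, where the vertex `1` is the crossing of
the edges `2 4` and `5 7`. Combinatorially the surface is the suspension `hexSusp` with the poles
`0`, `1` over the hexagon `2 3 4 5 6 7`, and `vertex` gives its vertices, as functions of
`C = cos β`, `S = sin β` and the normalizing factor `N` of the vertex `1`.

The proof rests on the following.

* The map which extends the positions of the vertices linearly to the cone over the complex is
  injective (`vertex_coneInjective`). This gives the absence of self-intersections, and together
  with a complete fan in `ℝ³` of the same combinatorial type the homeomorphism with the sphere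
  (`ConeInjective.sphereHomeomorphic`). The surface is not convex, since the vertex `7` is an
  interior point of the hull of the vertices (`vertex_not_convexSurface`).
* A dihedral angle depends only on the line of the edge and on the half-planes of the two faces
  (`dihedralAngle_transport`), so that each of them is `π` or equals one of a fixed configuration
  (`dihedralAngle_vertex_eq`).
* The distance of the vertices `4` and `7` determines `S`, so that no two polyhedra of the family
  are congruent (`path_not_congruent`).
* At the vertex `0` only the angles of the triangles `0 4 5` and `0 7 2` change
  (`gaussCurvature_path_ne`).
* Among the edges whose dihedral angle is not `π`, only those at the vertex `1` change their
  lengths. This vertex moves along the edge `2 4` of `T`, so that the reflex part `1 4` grows and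
  the convex part `1 2` shrinks; both decrease the total mean curvature
  (`totalMeanCurvature_path_lt`).
* The hyperbolic area of a small triangle is close to its Euclidean area, which is determined by a
  Gram determinant (`triArea_bounds`); this separates the areas at the ends of the path
  (`surfaceArea_path_lt`).
-/

noncomputable section

namespace HypPoly

/-! ### The Lorentz form and normalization to the hyperboloid -/

lemma lor_comm (x y : Fin 4 → ℝ) : lor x y = lor y x := by
  simp only [lor]; ring

lemma lor_add_left (x y z : Fin 4 → ℝ) : lor (x + y) z = lor x z + lor y z := by
  simp only [lor, Pi.add_apply]; ring

lemma lor_smul_left (a : ℝ) (x z : Fin 4 → ℝ) : lor (a • x) z = a * lor x z := by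
  simp only [lor, Pi.smul_apply, smul_eq_mul]; ring

lemma lor_add_right (x y z : Fin 4 → ℝ) : lor x (y + z) = lor x y + lor x z := by
  simp only [lor, Pi.add_apply]; ring

lemma lor_smul_right (a : ℝ) (x z : Fin 4 → ℝ) : lor x (a • z) = a * lor x z := by
  simp only [lor, Pi.smul_apply, smul_eq_mul]; ring

lemma lor_sub_left (x y z : Fin 4 → ℝ) : lor (x - y) z = lor x z - lor y z := by
  simp only [lor, Pi.sub_apply]; ring

lemma lor_sub_right (x y z : Fin 4 → ℝ) : lor x (y - z) = lor x y - lor x z := by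
  simp only [lor, Pi.sub_apply]; ring

lemma lor_sum_left {ι : Type*} (s : Finset ι) (c : ι → Fin 4 → ℝ) (z : Fin 4 → ℝ) :
    lor (∑ i ∈ s, c i) z = ∑ i ∈ s, lor (c i) z := by
  classical
  induction s using Finset.induction_on with
  | empty => simp [lor]
  | insert a s ha ih => rw [Finset.sum_insert ha, Finset.sum_insert ha, lor_add_left, ih]

@[fun_prop]
lemma continuous_lor {X : Type*} [TopologicalSpace X] {f g : X → Fin 4 → ℝ}
    (hf : Continuous f) (hg : Continuous g) : Continuous fun x => lor (f x) (g x) := by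
  unfold lor; fun_prop

/-- The reverse Cauchy–Schwarz inequality on the hyperboloid. -/
lemma one_le_neg_lor (x y : H3) : 1 ≤ -lor x.1 y.1 := by
  obtain ⟨x, hx, hx0⟩ := x
  obtain ⟨y, hy, hy0⟩ := y
  change 1 ≤ -lor x y
  simp only [lor] at hx hy ⊢
  have h : (1 + (x 1 * y 1 + x 2 * y 2 + x 3 * y 3)) ^ 2 ≤ (x 0 * y 0) ^ 2 := by
    have e1 : x 0 ^ 2 = 1 + x 1 ^ 2 + x 2 ^ 2 + x 3 ^ 2 := by linarith
    have e2 : y 0 ^ 2 = 1 + y 1 ^ 2 + y 2 ^ 2 + y 3 ^ 2 := by linarith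
    rw [mul_pow, e1, e2]
    nlinarith [sq_nonneg (x 1 - y 1), sq_nonneg (x 2 - y 2), sq_nonneg (x 3 - y 3),
      sq_nonneg (x 1 * y 2 - x 2 * y 1), sq_nonneg (x 1 * y 3 - x 3 * y 1),
      sq_nonneg (x 2 * y 3 - x 3 * y 2)]
  have := abs_le_of_sq_le_sq h (by positivity)
  linarith [le_abs_self (1 + (x 1 * y 1 + x 2 * y 2 + x 3 * y 3))]

/-- A conical combination of points of the hyperboloid is timelike. -/
lemma lor_sum_le {ι : Type*} (s : Finset ι) (p : ι → H3) (c : ι → ℝ) (hc : ∀ i ∈ s, 0 ≤ c i) :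
    lor (∑ i ∈ s, c i • (p i).1) (∑ i ∈ s, c i • (p i).1) ≤ -(∑ i ∈ s, c i) ^ 2 := by
  rw [lor_sum_left, sq, Finset.sum_mul, ← Finset.sum_neg_distrib]
  refine Finset.sum_le_sum fun i hi => ?_
  rw [lor_comm, lor_sum_left, Finset.mul_sum, ← Finset.sum_neg_distrib]
  refine Finset.sum_le_sum fun j hj => ?_
  rw [lor_smul_left, lor_smul_right]
  nlinarith [one_le_neg_lor (p j) (p i), mul_nonneg (hc i hi) (hc j hj)]

/-- The central projection of a timelike vector of the forward cone to the hyperboloid. -/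
def hnorm (y : Fin 4 → ℝ) (h : lor y y < 0) (h0 : 0 < y 0) : H3 :=
  ⟨(Real.sqrt (-lor y y))⁻¹ • y, by
    have hs : 0 < Real.sqrt (-lor y y) := Real.sqrt_pos.2 (by linarith)
    refine ⟨?_, by simpa using mul_pos (inv_pos.2 hs) h0⟩
    rw [lor_smul_left, lor_smul_right, ← mul_assoc, ← mul_inv, Real.mul_self_sqrt (by linarith)]
    rw [inv_neg, neg_mul, inv_mul_cancel₀ h.ne]⟩

lemma hnorm_val (y : Fin 4 → ℝ) (h : lor y y < 0) (h0 : 0 < y 0) :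
    (hnorm y h h0).1 = (Real.sqrt (-lor y y))⁻¹ • y := rfl

lemma exists_pos_smul_H3 (y : Fin 4 → ℝ) (h : lor y y < 0) (h0 : 0 < y 0) :
    ∃ z : H3, ∃ a : ℝ, 0 < a ∧ z.1 = a • y :=
  ⟨hnorm y h h0, _, inv_pos.2 (Real.sqrt_pos.2 (by linarith)), rfl⟩

/-- A point of the hyperboloid is determined by the ray through it. -/
lemma eq_one_of_smul_H3 {x y : H3} {a : ℝ} (h : x.1 = a • y.1) : a = 1 := by
  have h1 := x.2.1
  have h0 := x.2.2
  rw [h, lor_smul_left, lor_smul_right, y.2.1] at h1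
  rw [h] at h0
  have ha : 0 < a := by
    have : 0 < a * y.1 0 := by simpa using h0
    exact pos_of_mul_pos_left this y.2.2.le
  nlinarith

/-! ### Realizations whose faces span a fan of cones -/

section Fan
variable {n : ℕ}

/-- The conical combination of the vertices with the coefficients `c`. -/
def coneSum (p : Fin n → H3) (c : Fin n → ℝ) : Fin 4 → ℝ := ∑ i, c i • (p i).1

/-- Nonnegative coefficients which vanish outside some face: the points of the cone over
the geometric realization of the complex. -/
def Supported (K : OrientedTriangulation n) (c : Fin n → ℝ) : Prop :=
  (∀ i, 0 ≤ c i) ∧ ∃ f ∈ K.faces, ∀ i ∉ faceVerts f, c i = 0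

/-- The linear extension over the cones of the faces is injective on the cone over the complex. -/
def ConeInjective (K : OrientedTriangulation n) (p : Fin n → H3) : Prop :=
  ∀ c c', Supported K c → Supported K c' → coneSum p c = coneSum p c' → c = c'

lemma coneSum_smul (p : Fin n → H3) (a : ℝ) (c : Fin n → ℝ) :
    coneSum p (a • c) = a • coneSum p c := by
  simp [coneSum, Finset.smul_sum, mul_smul]

lemma Supported.smul {K : OrientedTriangulation n} {c : Fin n → ℝ} (hc : Supported K c) {a : ℝ}
    (ha : 0 ≤ a) : Supported K (a • c) := by
  obtain ⟨h0, f, hf, h⟩ := hc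
  exact ⟨fun i => mul_nonneg ha (h0 i), f, hf, fun i hi => by simp [h i hi]⟩

lemma coneSum_ite (p : Fin n → H3) (s : Finset (Fin n)) (c : Fin n → ℝ) :
    coneSum p (fun i => if i ∈ s then c i else 0) = ∑ i ∈ s, c i • (p i).1 := by
  simp [coneSum, ite_smul, Finset.sum_ite_mem]

lemma supported_ite {K : OrientedTriangulation n} {f : Fin n × Fin n × Fin n} (hf : f ∈ K.faces)
    {c : Fin n → ℝ} (hc : ∀ i ∈ faceVerts f, 0 ≤ c i) :
    Supported K (fun i => if i ∈ faceVerts f then c i else 0) := by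
  refine ⟨fun i => ?_, f, hf, fun i hi => by simp [hi]⟩
  by_cases h : i ∈ faceVerts f
  · simpa [h] using hc i h
  · simp [h]

/-- Positive and negative parts turn a linear dependence into two points of the same cone. -/
lemma ConeInjective.eq_zero {K : OrientedTriangulation n} {p : Fin n → H3}
    (h : ConeInjective K p) {f : Fin n × Fin n × Fin n} (hf : f ∈ K.faces) (c : Fin n → ℝ)
    (hc : ∀ i ∉ faceVerts f, c i = 0) (h0 : coneSum p c = 0) : c = 0 := by
  have key := h (fun i => max (c i) 0) (fun i => max (-c i) 0)
    ⟨fun i => le_max_right _ _, f, hf, fun i hi => by simp [hc i hi]⟩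
    ⟨fun i => le_max_right _ _, f, hf, fun i hi => by simp [hc i hi]⟩ (by
      rw [← sub_eq_zero, ← h0]
      simp only [coneSum, ← Finset.sum_sub_distrib, ← sub_smul]
      refine Finset.sum_congr rfl fun i _ => ?_
      congr 1
      rcases le_total (c i) 0 with h | h <;> simp [h])
  ext i
  have := congrFun key i
  rcases le_total (c i) 0 with h | h
  · simp only [max_eq_right h, max_eq_left (neg_nonneg.2 h)] at this; simp; linarith
  · simp only [max_eq_left h, max_eq_right (neg_nonpos.2 h)] at this; simpa using this

lemma ConeInjective.linearIndependent {K : OrientedTriangulation n} {p : Fin n → H3}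
    (h : ConeInjective K p) {a b c : Fin n} (hf : (a, b, c) ∈ K.faces) :
    LinearIndependent ℝ ![(p a).1, (p b).1, (p c).1] := by
  have hab := K.ne_of_mem _ _ _ hf
  have hbc := K.ne_of_mem _ _ _ (K.rotate_mem _ _ _ hf)
  have hca := K.ne_of_mem _ _ _ (K.rotate_mem _ _ _ (K.rotate_mem _ _ _ hf))
  rw [Fintype.linearIndependent_iff]
  intro g hg
  have := h.eq_zero hf (Pi.single a (g 0) + Pi.single b (g 1) + Pi.single c (g 2))
    (by
      intro i hi
      simp only [faceVerts, Finset.mem_insert, Finset.mem_singleton, not_or] at hi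
      simp [hi.1, hi.2.1, hi.2.2])
    (by
      simp only [coneSum, Pi.add_apply, add_smul, Finset.sum_add_distrib, Pi.single_apply, ite_smul,
        zero_smul, Finset.sum_ite_eq', Finset.mem_univ, if_true]
      simpa [Fin.sum_univ_three] using hg)
  have ha := congrFun this a
  have hb := congrFun this b
  have hc := congrFun this c
  simp [hab, hca.symm] at ha
  simp [hab.symm, hbc] at hb
  simp [hbc.symm, hca] at hc
  intro i
  fin_cases i <;> assumption

lemma ConeInjective.noSelfIntersections {K : OrientedTriangulation n} {p : Fin n → H3}
    (h : ConeInjective K p) : NoSelfIntersections K p := by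
  refine ⟨fun a b c hf => h.linearIndependent hf, fun f hf g hg => ?_⟩
  ext x
  constructor
  · rintro ⟨⟨c, hc, hx⟩, ⟨c', hc', hx'⟩⟩
    have key := h _ _ (supported_ite hf hc) (supported_ite hg hc') (by
      rw [coneSum_ite, coneSum_ite, ← hx, ← hx'])
    refine ⟨c, fun i hi => hc i (Finset.mem_inter.1 hi).1, ?_⟩
    rw [hx, ← Finset.sum_subset Finset.inter_subset_left]
    intro i hi hi'
    have := congrFun key i
    have hg' : i ∉ faceVerts g := fun h => hi' (Finset.mem_inter.2 ⟨hi, h⟩)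
    simp only [hi, hg', if_true, if_false] at this
    simp [this]
  · rintro ⟨c, hc, hx⟩
    constructor
    · refine ⟨fun i => if i ∈ faceVerts f ∩ faceVerts g then c i else 0, fun i _ => ?_, ?_⟩
      · dsimp only; split_ifs with h
        · exact hc i h
        · exact le_rfl
      · simp only [ite_smul, zero_smul, Finset.sum_ite_mem]
        rw [hx, ← Finset.inter_assoc, Finset.inter_self]
    · refine ⟨fun i => if i ∈ faceVerts f ∩ faceVerts g then c i else 0, fun i _ => ?_, ?_⟩
      · dsimp only; split_ifs with h
        · exact hc i h
        · exact le_rfl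
      · simp only [ite_smul, zero_smul, Finset.sum_ite_mem]
        rw [hx, Finset.inter_comm (faceVerts f), ← Finset.inter_assoc, Finset.inter_self]

lemma lor_coneSum_neg (p : Fin n → H3) {c : Fin n → ℝ} (hc : ∀ i, 0 ≤ c i) (h : c ≠ 0) :
    lor (coneSum p c) (coneSum p c) < 0 ∧ 0 < coneSum p c 0 := by
  obtain ⟨j, hj⟩ := Function.ne_iff.1 h
  have hj : 0 < c j := lt_of_le_of_ne (hc j) (Ne.symm hj)
  constructor
  · have h1 := lor_sum_le Finset.univ p c (fun i _ => hc i)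
    have : 0 < ∑ i, c i := Finset.sum_pos' (fun i _ => hc i) ⟨j, Finset.mem_univ j, hj⟩
    exact lt_of_le_of_lt h1 (by nlinarith)
  · simp only [coneSum, Finset.sum_apply, Pi.smul_apply, smul_eq_mul]
    exact Finset.sum_pos' (fun i _ => mul_nonneg (hc i) (p i).2.2.le)
      ⟨j, Finset.mem_univ j, mul_pos hj (p j).2.2⟩

open Classical in
lemma mem_surface_iff {K : OrientedTriangulation n} {p : Fin n → H3} {x : H3} :
    x ∈ surface K p ↔ ∃ c, Supported K c ∧ x.1 = coneSum p c := by
  simp only [surface, Set.mem_iUnion, exists_prop]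
  constructor
  · rintro ⟨f, hf, c, hc, hx⟩
    exact ⟨_, supported_ite hf hc, by rw [coneSum_ite, hx]⟩
  · rintro ⟨c, ⟨h0, f, hf, hc⟩, hx⟩
    refine ⟨f, hf, c, fun i _ => h0 i, ?_⟩
    rw [hx, coneSum]
    refine (Finset.sum_subset (Finset.subset_univ _) fun i _ hi => ?_).symm
    simp [hc i hi]

/-- If the complex also spans a complete fan in `ℝ³`, with generators `q` and continuous
piecewise linear coefficient functions `coef`, then radial projection identifies the surface with
the sphere. -/
lemma ConeInjective.sphereHomeomorphic {K : OrientedTriangulation n} {p : Fin n → H3}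
    (h : ConeInjective K p) (q : Fin n → EuclideanSpace ℝ (Fin 3))
    (coef : EuclideanSpace ℝ (Fin 3) → Fin n → ℝ) (hcont : Continuous coef)
    (hsupp : ∀ s, Supported K (coef s)) (hq : ∀ s, ∑ i, coef s i • q i = s)
    (hcoef : ∀ c, Supported K c → coef (∑ i, c i • q i) = c) : SphereHomeomorphic K p := by
  have hne : ∀ s : Metric.sphere (0 : EuclideanSpace ℝ (Fin 3)) 1, coef s.1 ≠ 0 := by
    intro s hs
    have h1 := hq s.1
    rw [hs] at h1
    have h2 := norm_eq_of_mem_sphere s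
    rw [← h1] at h2
    simp at h2
  have hneg := fun s => lor_coneSum_neg p (hsupp _).1 (hne s)
  have hpos : ∀ s : Metric.sphere (0 : EuclideanSpace ℝ (Fin 3)) 1,
      0 < (Real.sqrt (-lor (coneSum p (coef s.1)) (coneSum p (coef s.1))))⁻¹ :=
    fun s => inv_pos.2 (Real.sqrt_pos.2 (by linarith [(hneg s).1]))
  let F : Metric.sphere (0 : EuclideanSpace ℝ (Fin 3)) 1 → surface K p := fun s =>
    ⟨hnorm (coneSum p (coef s.1)) (hneg s).1 (hneg s).2, mem_surface_iff.2
      ⟨_, (hsupp s.1).smul (hpos s).le, by rw [coneSum_smul, hnorm_val]⟩⟩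
  have hcs : Continuous fun s : Metric.sphere (0 : EuclideanSpace ℝ (Fin 3)) 1 =>
      coneSum p (coef s.1) := by
    unfold coneSum
    have : Continuous fun s : Metric.sphere (0 : EuclideanSpace ℝ (Fin 3)) 1 => coef s.1 :=
      hcont.comp continuous_subtype_val
    exact continuous_finsetSum _ fun i _ =>
      ((continuous_apply i).comp this).smul continuous_const
  have hF : Continuous F := by
    refine Continuous.subtype_mk (Continuous.subtype_mk ?_ _) _
    refine Continuous.fun_smul (Continuous.inv₀ ?_ ?_) hcs
    · exact Real.continuous_sqrt.comp (continuous_lor hcs hcs).neg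
    · exact fun s => (inv_pos.1 (hpos s)).ne'
  have hFval : ∀ s, ∃ a : ℝ, 0 < a ∧ (F s).1.1 = coneSum p (a • coef s.1) :=
    fun s => ⟨_, hpos s, by rw [coneSum_smul]; rfl⟩
  have hinj : Function.Injective F := by
    intro s t hst
    obtain ⟨a, ha, hs⟩ := hFval s
    obtain ⟨b, hb, ht⟩ := hFval t
    have h1 := h _ _ ((hsupp s.1).smul ha.le) ((hsupp t.1).smul hb.le) (by rw [← hs, ← ht, hst])
    have h2 : a • s.1 = b • t.1 := by
      have := congrArg (fun c : Fin n → ℝ => ∑ i, c i • q i) h1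
      simpa only [Pi.smul_apply, smul_eq_mul, mul_smul, ← Finset.smul_sum, hq] using this
    have h3 := congrArg norm h2
    rw [norm_smul, norm_smul, norm_eq_of_mem_sphere, norm_eq_of_mem_sphere, mul_one, mul_one,
      Real.norm_of_nonneg ha.le, Real.norm_of_nonneg hb.le] at h3
    rw [h3] at h2
    exact Subtype.ext (smul_right_injective _ hb.ne' h2)
  have hsurj : Function.Surjective F := by
    rintro ⟨x, hx⟩
    obtain ⟨c, hc, hxc⟩ := mem_surface_iff.1 hx
    set s := ∑ i, c i • q i with hs
    have hcs : coef s = c := hcoef c hc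
    have hs0 : s ≠ 0 := by
      intro h0
      have hz : coef 0 = 0 := by
        have hz : Supported K (0 : Fin n → ℝ) := ⟨fun i => le_rfl, hc.2.imp fun f hf =>
          ⟨hf.1, fun i _ => rfl⟩⟩
        simpa using hcoef 0 hz
      rw [h0, hz] at hcs
      have := x.2.2
      rw [hxc, ← hcs] at this
      simp [coneSum] at this
    have hn : 0 < ‖s‖ := norm_pos_iff.2 hs0
    refine ⟨⟨‖s‖⁻¹ • s, by simp [norm_smul, hn.ne']⟩, ?_⟩
    obtain ⟨a, ha, hF'⟩ := hFval ⟨‖s‖⁻¹ • s, by simp [norm_smul, hn.ne']⟩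
    have hcoe : coef (‖s‖⁻¹ • s) = ‖s‖⁻¹ • c := by
      have h1 := hcoef _ (hc.smul (inv_nonneg.2 hn.le))
      rw [← h1]
      congr 1
      simp only [Pi.smul_apply, smul_eq_mul, mul_smul, ← Finset.smul_sum, hs]
    have h2 : (F ⟨‖s‖⁻¹ • s, by simp [norm_smul, hn.ne']⟩).1.1 = (a * ‖s‖⁻¹) • x.1 := by
      rw [hF', hxc, hcoe, smul_smul, coneSum_smul]
    have h3 := eq_one_of_smul_H3 h2
    rw [h3, one_smul] at h2
    exact Subtype.ext (Subtype.ext h2)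
  exact ⟨(hF.homeoOfEquivCompactToT2 (f := Equiv.ofBijective F ⟨hinj, hsurj⟩)).symm⟩

end Fan

/-! ### The suspension over a hexagon -/

/-- The faces of the suspension with the poles `0`, `1` over the hexagon `2, 3, 4, 5, 6, 7`, each of
them listed once, starting with its pole. -/
def hexFaces : Finset (Fin 8 × Fin 8 × Fin 8) :=
  {(0, 2, 3), (0, 3, 4), (0, 4, 5), (0, 5, 6), (0, 6, 7), (0, 7, 2),
    (1, 3, 2), (1, 4, 3), (1, 5, 4), (1, 6, 5), (1, 7, 6), (1, 2, 7)}

/-- The suspension over a hexagon, as an oriented triangulation with `8` vertices. -/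
def hexSusp : OrientedTriangulation 8 where
  faces := hexFaces ∪ hexFaces.image (fun f => (f.2.1, f.2.2, f.1)) ∪
    hexFaces.image (fun f => (f.2.2, f.1, f.2.1))
  ne_of_mem := by decide +kernel
  rotate_mem := by decide +kernel
  unique_third := by decide +kernel
  exists_opposite := by decide +kernel
  exists_face := by decide +kernel

lemma hexSusp_facesOnce : hexSusp.facesOnce = hexFaces := by decide +kernel

/-- The rotation by a half-turn of the hexagon, which fixes the poles. -/
def hexFlip : Fin 8 → Fin 8 := ![0, 1, 5, 6, 7, 2, 3, 4]

/-- Up to the half-turn and the reversal of edges there are nine hinges. -/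
lemma hexSusp_hinge_induction {Q : Fin 8 → Fin 8 → Fin 8 → Fin 8 → Prop}
    (hrev : ∀ a b c d, Q a b c d → Q b a d c)
    (hflip : ∀ a b c d, Q a b c d → Q (hexFlip a) (hexFlip b) (hexFlip c) (hexFlip d))
    (h023 : Q 0 2 3 7) (h034 : Q 0 3 4 2) (h045 : Q 0 4 5 3)
    (h127 : Q 1 2 7 3) (h132 : Q 1 3 2 4) (h143 : Q 1 4 3 5)
    (h230 : Q 2 3 0 1) (h340 : Q 3 4 0 1) (h450 : Q 4 5 0 1) :
    ∀ a b c d, hexSusp.IsHinge a b c d → Q a b c d := by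
  have key : ∀ f ∈ hexSusp.faces, ∀ g ∈ hexSusp.faces, g.1 = f.2.1 → g.2.1 = f.1 →
      ∃ h ∈ ({(0, 2, 3, 7), (0, 3, 4, 2), (0, 4, 5, 3), (1, 2, 7, 3), (1, 3, 2, 4), (1, 4, 3, 5),
        (2, 3, 0, 1), (3, 4, 0, 1), (4, 5, 0, 1)} : Finset (Fin 8 × Fin 8 × Fin 8 × Fin 8)),
        (f.1, f.2.1, f.2.2, g.2.2) = h ∨
        (f.2.1, f.1, g.2.2, f.2.2) = h ∨
        (hexFlip f.1, hexFlip f.2.1, hexFlip f.2.2, hexFlip g.2.2) = h ∨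
        (hexFlip f.2.1, hexFlip f.1, hexFlip g.2.2, hexFlip f.2.2) = h := by
    decide +kernel
  have hbase : ∀ h ∈ ({(0, 2, 3, 7), (0, 3, 4, 2), (0, 4, 5, 3), (1, 2, 7, 3), (1, 3, 2, 4),
      (1, 4, 3, 5), (2, 3, 0, 1), (3, 4, 0, 1), (4, 5, 0, 1)} :
      Finset (Fin 8 × Fin 8 × Fin 8 × Fin 8)), Q h.1 h.2.1 h.2.2.1 h.2.2.2 := by
    simp only [Finset.forall_mem_insert, Finset.mem_singleton, forall_eq]
    exact ⟨h023, h034, h045, h127, h132, h143, h230, h340, h450⟩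
  have hinv : ∀ i, hexFlip (hexFlip i) = i := by decide
  rintro a b c d ⟨h1, h2⟩
  obtain ⟨h, hh, e⟩ := key _ h1 _ h2 rfl rfl
  have hQ := hbase h hh
  rcases e with rfl | rfl | rfl | rfl
  · exact hQ
  · exact hrev _ _ _ _ hQ
  · simpa only [hinv] using hflip _ _ _ _ hQ
  · simpa only [hinv] using hrev _ _ _ _ (hflip _ _ _ _ hQ)

/-- The support of a point of the cone over the suspension: a pole and two adjacent vertices of
the hexagon. -/
lemma Supported.exists_hexFaces {c : Fin 8 → ℝ} (hc : Supported hexSusp c) :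
    ∃ f ∈ hexFaces, ∀ i ∉ faceVerts f, c i = 0 := by
  obtain ⟨-, f, hf, h⟩ := hc
  have key : ∀ f ∈ hexSusp.faces, ∃ g ∈ hexFaces, faceVerts g = faceVerts f := by decide +kernel
  obtain ⟨g, hg, e⟩ := key f hf
  exact ⟨g, hg, by rwa [e]⟩

/-- Two vertices which do not lie in a common face cannot both belong to a support. -/
lemma Supported.eq_zero_or {c : Fin 8 → ℝ} (hc : Supported hexSusp c) (i j : Fin 8)
    (hij : ∀ f ∈ hexFaces, i ∈ faceVerts f → j ∉ faceVerts f) : c i = 0 ∨ c j = 0 := by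
  obtain ⟨f, hf, h⟩ := hc.exists_hexFaces
  by_cases hi : i ∈ faceVerts f
  · exact Or.inr (h j (hij f hf hi))
  · exact Or.inl (h i hi)

/-- The rays of a complete fan in `ℝ³` which realizes the suspension. -/
def fanRay : Fin 8 → EuclideanSpace ℝ (Fin 3) :=
  ![!₂[0, 0, 1], !₂[0, 0, -1], !₂[1, 0, 0], !₂[1, 1, 0], !₂[0, 1, 0], !₂[-1, 0, 0], !₂[-1, -1, 0],
    !₂[0, -1, 0]]

/-- The coefficients of a vector with respect to the rays of the cone which contains it. -/
def fanCoef (s : EuclideanSpace ℝ (Fin 3)) : Fin 8 → ℝ :=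
  ![max (s 2) 0, max (-s 2) 0, max (s 0 - max (s 1) 0) 0, max (min (s 0) (s 1)) 0,
    max (s 1 - max (s 0) 0) 0, max (-s 0 - max (-s 1) 0) 0, max (min (-s 0) (-s 1)) 0,
    max (-s 1 - max (-s 0) 0) 0]

lemma continuous_fanCoef : Continuous fanCoef := by
  refine continuous_pi fun i => ?_
  fin_cases i <;> simp only [fanCoef] <;> simp <;> fun_prop

lemma fanCoef_supported (s : EuclideanSpace ℝ (Fin 3)) : Supported hexSusp (fanCoef s) := by
  refine ⟨fun i => by fin_cases i <;> simp [fanCoef], ?_⟩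
  have hsub : hexFaces ⊆ hexSusp.faces := by decide +kernel
  have key : ∃ f ∈ hexFaces, ∀ i ∉ faceVerts f, fanCoef s i = 0 := by
    have hz : ∀ f, (∀ i, i ∉ faceVerts f → fanCoef s i = 0) ↔
      ((0 ∉ faceVerts f → max (s 2) 0 = 0) ∧ (1 ∉ faceVerts f → max (-s 2) 0 = 0) ∧
      (2 ∉ faceVerts f → max (s 0 - max (s 1) 0) 0 = 0) ∧
      (3 ∉ faceVerts f → max (min (s 0) (s 1)) 0 = 0) ∧
      (4 ∉ faceVerts f → max (s 1 - max (s 0) 0) 0 = 0) ∧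
      (5 ∉ faceVerts f → max (-s 0 - max (-s 1) 0) 0 = 0) ∧
      (6 ∉ faceVerts f → max (min (-s 0) (-s 1)) 0 = 0) ∧
      (7 ∉ faceVerts f → max (-s 1 - max (-s 0) 0) 0 = 0)) := by
      intro f
      simp only [fanCoef, Fin.forall_fin_succ]
      simp
    simp only [hz, hexFaces, Finset.exists_mem_insert, Finset.mem_singleton,
      exists_eq_left]
    simp only [faceVerts, Finset.mem_insert, Finset.mem_singleton]
    norm_num [Fin.ext_iff]
    grind
  exact key.imp fun f hf => ⟨hsub hf.1, hf.2⟩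

lemma sum_fanCoef_smul (s : EuclideanSpace ℝ (Fin 3)) : ∑ i, fanCoef s i • fanRay i = s := by
  ext j
  simp only [Fin.sum_univ_eight]
  fin_cases j <;> simp [fanCoef, fanRay] <;> grind

set_option maxHeartbeats 1000000 in
lemma fanCoef_sum_smul (c : Fin 8 → ℝ) (hc : Supported hexSusp c) :
    fanCoef (∑ i, c i • fanRay i) = c := by
  obtain ⟨f, hf, h⟩ := hc.exists_hexFaces
  have h0 := hc.1
  have e0 : (∑ i, c i • fanRay i) 0 = c 2 + c 3 - c 5 - c 6 := by
    simp [Fin.sum_univ_eight, fanRay]; ring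
  have e1 : (∑ i, c i • fanRay i) 1 = c 3 + c 4 - c 6 - c 7 := by
    simp [Fin.sum_univ_eight, fanRay]; ring
  have e2 : (∑ i, c i • fanRay i) 2 = c 0 - c 1 := by
    simp [Fin.sum_univ_eight, fanRay]; ring
  have hall : ∀ (P : Fin 8 → Prop), (∀ i, P i) ↔ (P 0 ∧ P 1 ∧ P 2 ∧ P 3 ∧ P 4 ∧ P 5 ∧ P 6 ∧ P 7) :=
    fun P => by simp [Fin.forall_fin_succ]
  rw [funext_iff, hall]
  rw [hall] at h h0
  simp only [fanCoef, e0, e1, e2, Matrix.cons_val]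
  clear hall e0 e1 e2 hc
  obtain ⟨h00, h01, h02, h03, h04, h05, h06, h07⟩ := h0
  simp only [hexFaces, Finset.mem_insert, Finset.mem_singleton] at hf
  rcases hf with rfl | rfl | rfl | rfl | rfl | rfl | rfl | rfl | rfl | rfl | rfl | rfl <;>
  · simp [faceVerts] at h
    simp only [h, zero_add, add_zero, sub_zero, zero_sub]
    clear h
    refine ⟨?_, ?_, ?_, ?_, ?_, ?_, ?_, ?_⟩ <;> grind

/-- The surface of the suspension is a sphere. -/
lemma ConeInjective.sphereHomeomorphic_hexSusp {p : Fin 8 → H3} (h : ConeInjective hexSusp p) :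
    SphereHomeomorphic hexSusp p :=
  h.sphereHomeomorphic fanRay fanCoef continuous_fanCoef fanCoef_supported sum_fanCoef_smul
    fanCoef_sum_smul

section Polyhedra

/-! ### The polyhedra -/

/-- The parameters of a polyhedron of the family: `C` and `S` are the cosine and the sine of
the angle `β`, and `N` normalizes the vertex `1`. The bounds amount to
`7 / 24 ≤ tan β ≤ 3 / 4`. -/
structure Params (C S N : ℝ) : Prop where
  sq_add_sq : C ^ 2 + S ^ 2 = 1
  le_S : 7 / 25 ≤ S
  S_le : S ≤ 3 / 5
  le_C : 4 / 5 ≤ C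
  N_pos : 0 < N
  N_sq : N ^ 2 * (C ^ 2 - (80 / 1601) ^ 2) = 1

/-- The vertices. The tetrahedra `0 2 3 4` and `0 5 6 7` lie on opposite sides of the plane `x₃ = 0`
and are exchanged by the half-turn about the `x₁`-axis. They are obtained from tetrahedra which do
not depend on the parameters by the rotations about the `x₃`-axis by the angles `β` and `-β`. The
sides `2 4` and `5 7` of their bases meet in the vertex `1`. -/
def vec (C S N : ℝ) : Fin 8 → Fin 4 → ℝ :=
  ![![1, 0, 0, 0],
    ![N * C, N * (80 / 1601), 0, 0],
    ![161701 / 158301, 8080 / 158301 * C + 20 / 99 * S, 8080 / 158301 * S - 20 / 99 * C, 0],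
    ![1601 / 1599, 0, 0, 80 / 1599],
    ![1601 / 1599, 80 / 1599 * C, 80 / 1599 * S, 0],
    ![161701 / 158301, 8080 / 158301 * C + 20 / 99 * S, -(8080 / 158301 * S - 20 / 99 * C), 0],
    ![1601 / 1599, 0, 0, -(80 / 1599)],
    ![1601 / 1599, 80 / 1599 * C, -(80 / 1599 * S), 0]]

variable {C S N : ℝ}

lemma vec_mem (h : Params C S N) (i : Fin 8) :
    lor (vec C S N i) (vec C S N i) = -1 ∧ 0 < vec C S N i 0 := by
  have h1 := h.sq_add_sq
  have h2 := h.N_sq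
  have h3 := h.N_pos
  have h4 := h.le_C
  fin_cases i <;> simp [vec, lor]
  · refine ⟨by linear_combination -h2, by positivity⟩
  · linear_combination ((8080 / 158301) ^ 2 + (20 / 99) ^ 2) * h1
  · norm_num
  · linear_combination (80 / 1599) ^ 2 * h1
  · linear_combination ((8080 / 158301) ^ 2 + (20 / 99) ^ 2) * h1
  · norm_num
  · linear_combination (80 / 1599) ^ 2 * h1

/-- The realization of the suspension with the given parameters. -/
def vertex (h : Params C S N) (i : Fin 8) : H3 := ⟨vec C S N i, vec_mem h i⟩

lemma Params.S_pos (h : Params C S N) : 0 < S := by linarith [h.le_S]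

lemma Params.C_pos (h : Params C S N) : 0 < C := by linarith [h.le_C]

/-- The bases of the two tetrahedra have interior points on the `x₁`-axis. -/
lemma Params.base_pos (h : Params C S N) : 0 < 20 / 99 * C - 8080 / 158301 * S := by
  linarith [h.le_C, h.S_le]

/-- The vertices `4` and `7` lie inside the base of the other tetrahedron: the angle `2 β` is less
than the angle of the bases at `0`. -/
lemma Params.angle_pos (h : Params C S N) :
    0 < 20 / 99 * (C ^ 2 - S ^ 2) - 2 * (8080 / 158301) * S * C := by
  have h1 : 0 ≤ 3 * C - 4 * S := by linarith [h.le_C, h.S_le]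
  nlinarith [mul_nonneg h1 h.C_pos.le, mul_nonneg h1 h.S_pos.le, pow_pos h.C_pos 2]

/-- The vertices `0` and `1` lie on different sides of the line through the vertices `2` and `7`
of the plane `x₃ = 0`. -/
lemma Params.eq_zero_of_base (h : Params C S N) {d₀ d₁ d₂ d₇ : ℝ}
    (e0 : d₀ + d₁ * (N * C) + d₂ * (161701 / 158301) + d₇ * (1601 / 1599) = 0)
    (e1 : d₁ * (N * (80 / 1601)) + d₂ * (8080 / 158301 * C + 20 / 99 * S) +
      d₇ * (80 / 1599 * C) = 0)
    (e2 : d₂ * (8080 / 158301 * S - 20 / 99 * C) - d₇ * (80 / 1599 * S) = 0)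
    (hd : d₀ * d₁ ≤ 0) : d₀ = 0 ∧ d₁ = 0 ∧ d₂ = 0 ∧ d₇ = 0 := by
  have hu := h.base_pos
  have hg := h.angle_pos
  have hN := h.N_pos
  have hS := h.S_pos
  have hC := h.C_pos
  have hsq := h.sq_add_sq
  set u := 20 / 99 * C - 8080 / 158301 * S with hu'
  set g := 20 / 99 * (C ^ 2 - S ^ 2) - 2 * (8080 / 158301) * S * C with hg'
  have k1 : d₁ * (N * (80 / 1601)) * u = -(d₇ * (80 / 1599) * g) := by
    rw [hu', hg']
    linear_combination u * e1 + (8080 / 158301 * C + 20 / 99 * S) * e2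
  have k0 : d₀ = -(2 * S ^ 2 * (1601 / 1599) * d₇) := by
    have : u * (d₀ + 2 * S ^ 2 * (1601 / 1599) * d₇) = 0 := by
      rw [hu']
      linear_combination u * e0 + (161701 / 158301) * e2 - C * (1601 / 80) * k1 +
        ((1601 / 1599) * d₇ * (2 * (20 / 99 * C - 8080 / 158301 * S)) -
          32020 / 158301 * C * d₇) * hsq
    rcases mul_eq_zero.1 this with h | h
    · exact absurd h hu.ne'
    · linarith
  have k7 : d₇ = 0 := by
    by_contra h7
    have : 0 < d₀ * (d₁ * (N * (80 / 1601)) * u) := by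
      rw [k0, k1]
      have : 0 < d₇ ^ 2 := by positivity
      calc (0 : ℝ) < 2 * S ^ 2 * (1601 / 1599) * (80 / 1599) * g * d₇ ^ 2 := by positivity
        _ = _ := by ring
    have h2 : d₀ * (d₁ * (N * (80 / 1601)) * u) = (d₀ * d₁) * (N * (80 / 1601) * u) := by ring
    rw [h2] at this
    exact absurd (mul_nonpos_of_nonpos_of_nonneg hd (by positivity)) (not_le.2 this)
  have k2 : d₂ = 0 := by
    have : d₂ * u = 0 := by rw [hu']; linear_combination -e2 - 80 / 1599 * S * k7
    exact (mul_eq_zero.1 this).resolve_right hu.ne'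
  have k1' : d₁ = 0 := by
    rw [k7] at k1
    have : d₁ * (N * (80 / 1601) * u) = 0 := by linarith
    exact (mul_eq_zero.1 this).resolve_right (by positivity)
  exact ⟨by rw [k0, k7]; ring, k1', k2, k7⟩

set_option maxHeartbeats 1000000 in
lemma vertex_coneInjective (h : Params C S N) : ConeInjective hexSusp (vertex h) := by
  intro c c' hc hc' e
  have E0 := congrFun e 0
  have E1 := congrFun e 1
  have E2 := congrFun e 2
  have E3 := congrFun e 3
  simp [coneSum, Fin.sum_univ_eight, vertex, vec] at E0 E1 E2 E3
  have hu := h.base_pos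
  have hS := h.S_pos
  have p0 := hc.1
  have p0' := hc'.1
  have opp : ∀ i j : Fin 8, (∀ f ∈ hexFaces, i ∈ faceVerts f → j ∉ faceVerts f) →
      c i * c j = 0 ∧ c' i * c' j = 0 := fun i j hij =>
    ⟨mul_eq_zero.2 (hc.eq_zero_or i j hij), mul_eq_zero.2 (hc'.eq_zero_or i j hij)⟩
  have o01 := opp 0 1 (by decide +kernel)
  have o36 := opp 3 6 (by decide +kernel)
  have o25 := opp 2 5 (by decide +kernel)
  have o24 := opp 2 4 (by decide +kernel)
  have o75 := opp 7 5 (by decide +kernel)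
  have o74 := opp 7 4 (by decide +kernel)
  have h36 : c 3 - c 6 = c' 3 - c' 6 := by linarith
  have h3 : c 3 = c' 3 := by
    rcases mul_eq_zero.1 o36.1 with h | h <;> rcases mul_eq_zero.1 o36.2 with h' | h' <;>
      linarith [p0 3, p0 6, p0' 3, p0' 6]
  have h6 : c 6 = c' 6 := by linarith
  have hd : (c 0 - c' 0) * (c 1 - c' 1) ≤ 0 := by
    nlinarith [mul_nonneg (p0 0) (p0' 1), mul_nonneg (p0 1) (p0' 0), o01.1, o01.2]
  -- The weights of the vertices on the two sides of the `x₁`-axis.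
  set u := 20 / 99 * C - 8080 / 158301 * S with hu'
  have hL : ∀ x y : ℝ, 0 ≤ x → 0 ≤ y → 0 ≤ x * u + y * (80 / 1599 * S) :=
    fun x y hx hy => by positivity
  have hL0 : ∀ x y : ℝ, 0 ≤ x → 0 ≤ y → x * u + y * (80 / 1599 * S) = 0 → x = 0 ∧ y = 0 := by
    intro x y hx hy hxy
    have h1 : 0 ≤ x * u := by positivity
    have h2 : 0 ≤ y * (80 / 1599 * S) := by positivity
    exact ⟨(mul_eq_zero.1 (by linarith : x * u = 0)).resolve_right hu.ne',
      (mul_eq_zero.1 (by linarith : y * (80 / 1599 * S) = 0)).resolve_right (by positivity)⟩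
  have hsplit : ∀ x : Fin 8 → ℝ, (∀ i, 0 ≤ x i) → x 2 * x 5 = 0 → x 2 * x 4 = 0 → x 7 * x 5 = 0 →
      x 7 * x 4 = 0 → (x 2 = 0 ∧ x 7 = 0) ∨ (x 5 = 0 ∧ x 4 = 0) := by
    intro x _ h1 h2 h3 h4
    simp only [mul_eq_zero] at h1 h2 h3 h4
    tauto
  have E2' : (c 5 * u + c 4 * (80 / 1599 * S)) - (c 2 * u + c 7 * (80 / 1599 * S)) =
      (c' 5 * u + c' 4 * (80 / 1599 * S)) - (c' 2 * u + c' 7 * (80 / 1599 * S)) := by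
    rw [hu']; linear_combination E2
  have a1 := hsplit c p0 o25.1 o24.1 o75.1 o74.1
  have a2 := hsplit c' p0' o25.2 o24.2 o75.2 o74.2
  have q1 := hL _ _ (p0 5) (p0 4)
  have q2 := hL _ _ (p0 2) (p0 7)
  have q3 := hL _ _ (p0' 5) (p0' 4)
  have q4 := hL _ _ (p0' 2) (p0' 7)
  have side : (c 5 = 0 ∧ c 4 = 0 ∧ c' 5 = 0 ∧ c' 4 = 0) ∨
      (c 2 = 0 ∧ c 7 = 0 ∧ c' 2 = 0 ∧ c' 7 = 0) := by
    rcases a1 with ⟨b1, b2⟩ | ⟨b1, b2⟩ <;> rcases a2 with ⟨b3, b4⟩ | ⟨b3, b4⟩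
    · exact Or.inr ⟨b1, b2, b3, b4⟩
    · rw [b1, b2, b3, b4] at E2'
      obtain ⟨b5, b6⟩ := hL0 _ _ (p0 5) (p0 4) (by linarith)
      exact Or.inl ⟨b5, b6, b3, b4⟩
    · rw [b1, b2, b3, b4] at E2'
      obtain ⟨b5, b6⟩ := hL0 _ _ (p0 2) (p0 7) (by linarith)
      exact Or.inr ⟨b5, b6, b3, b4⟩
    · exact Or.inl ⟨b1, b2, b3, b4⟩
  have all : c 0 = c' 0 ∧ c 1 = c' 1 ∧ c 2 = c' 2 ∧ c 4 = c' 4 ∧ c 5 = c' 5 ∧ c 7 = c' 7 := by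
    rcases side with ⟨b5, b4, b5', b4'⟩ | ⟨b2, b7, b2', b7'⟩
    · rw [b5, b4, b5', b4', h3, h6] at E0
      rw [b5, b4, b5', b4'] at E1 E2
      obtain ⟨r0, r1, r2, r7⟩ := h.eq_zero_of_base (d₀ := c 0 - c' 0) (d₁ := c 1 - c' 1)
        (d₂ := c 2 - c' 2) (d₇ := c 7 - c' 7) (by linear_combination E0)
        (by linear_combination E1) (by linear_combination E2) hd
      refine ⟨by linarith, by linarith, by linarith, by linarith, by linarith, by linarith⟩
    · rw [b2, b7, b2', b7', h3, h6] at E0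
      rw [b2, b7, b2', b7'] at E1 E2
      obtain ⟨r0, r1, r5, r4⟩ := h.eq_zero_of_base (d₀ := c 0 - c' 0) (d₁ := c 1 - c' 1)
        (d₂ := c 5 - c' 5) (d₇ := c 4 - c' 4) (by linear_combination E0)
        (by linear_combination E1) (by linear_combination -E2) hd
      refine ⟨by linarith, by linarith, by linarith, by linarith, by linarith, by linarith⟩
  obtain ⟨r0, r1, r2, r4, r5, r7⟩ := all
  ext i
  fin_cases i <;> assumption

end Polyhedra

section PolyhedraProperties

variable {C S N : ℝ}

/-! ### The polyhedra are embedded spheres -/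

lemma kleinDet_eq (u v w : H3) : kleinDet u v w =
    (u.1 1 * (v.1 2 * w.1 3 - v.1 3 * w.1 2) - u.1 2 * (v.1 1 * w.1 3 - v.1 3 * w.1 1) +
      u.1 3 * (v.1 1 * w.1 2 - v.1 2 * w.1 1)) / (u.1 0 * v.1 0 * w.1 0) := by
  have hu := u.2.2.ne'
  have hv := v.2.2.ne'
  have hw := w.2.2.ne'
  refine (Matrix.det_fin_three _).trans ?_
  simp
  field_simp
  ring

lemma vertex_outwardOriented (h : Params C S N) : OutwardOriented hexSusp (vertex h) := by
  have hu := h.base_pos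
  have hu' : 8080 / 158301 * S - 20 / 99 * C < 0 := by linarith
  have hN := h.N_pos
  have hC := h.C_pos
  have hS := h.S_pos
  rw [OutwardOriented, hexSusp_facesOnce]
  have e : ∀ f ∈ hexFaces, 0 ≤ kleinDet (vertex h f.1) (vertex h f.2.1) (vertex h f.2.2) := by
    intro f hf
    rw [kleinDet_eq]
    refine div_nonneg ?_ (by
      have := fun i => (vertex h i).2.2
      exact (mul_pos (mul_pos (this _) (this _)) (this _)).le)
    revert f
    simp only [hexFaces, Finset.forall_mem_insert, Finset.mem_singleton, forall_eq]
    simp [vertex, vec, -mul_neg]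
    exact ⟨by nlinarith, by positivity, by positivity, by nlinarith [mul_pos hN hS]⟩
  refine Finset.sum_pos' e ⟨(1, 3, 2), by decide +kernel, ?_⟩
  rw [kleinDet_eq]
  refine div_pos ?_ (by
    have := fun i => (vertex h i).2.2
    exact (mul_pos (mul_pos (this _) (this _)) (this _)))
  simp [vertex, vec]
  nlinarith

lemma vertex_isEmbeddedSphere (h : Params C S N) : IsEmbeddedSphere hexSusp (vertex h) :=
  ⟨(vertex_coneInjective h).noSelfIntersections,
    (vertex_coneInjective h).sphereHomeomorphic_hexSusp, vertex_outwardOriented h⟩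

/-! ### The surfaces are not convex -/

lemma GeodConvex.mem_of_sum {n : ℕ} {A : Set H3} (hA : GeodConvex A) (p : Fin n → H3)
    (s : Finset (Fin n)) (c : Fin n → ℝ) (hp : ∀ i ∈ s, p i ∈ A) (hc : ∀ i ∈ s, 0 ≤ c i) (z : H3)
    (hz : z.1 = ∑ i ∈ s, c i • (p i).1) : z ∈ A := by
  induction s using Finset.induction_on generalizing z c with
  | empty =>
    have := z.2.2
    simp [hz] at this
  | insert a s ha ih =>
    rw [Finset.sum_insert ha] at hz
    have hpa := hp a (Finset.mem_insert_self a s)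
    have hca := hc a (Finset.mem_insert_self a s)
    by_cases h0 : (fun i => if i ∈ s then c i else 0) = 0
    · have : ∑ i ∈ s, c i • (p i).1 = 0 := by rw [← coneSum_ite, h0]; simp [coneSum]
      rw [this] at hz
      exact hA _ hpa _ hpa ⟨c a, 0, hca, le_rfl, by rw [hz]; simp⟩
    · obtain ⟨h1, h2⟩ := lor_coneSum_neg p (c := fun i => if i ∈ s then c i else 0) (fun i => by
        split_ifs with h
        · exact hc i (Finset.mem_insert_of_mem h)
        · exact le_rfl) h0
      rw [coneSum_ite] at h1 h2
      obtain ⟨y, b, hb, hy⟩ := exists_pos_smul_H3 _ h1 h2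
      have hyA : y ∈ A := ih (fun i => b * c i) (fun i hi => hp i (Finset.mem_insert_of_mem hi))
        (fun i hi => mul_nonneg hb.le (hc i (Finset.mem_insert_of_mem hi))) y (by
          rw [hy, Finset.smul_sum]
          simp only [smul_smul])
      exact hA _ hpa _ hyA ⟨c a, b⁻¹, hca, (inv_pos.2 hb).le, by
        rw [hz, hy, smul_smul, inv_mul_cancel₀ hb.ne', one_smul]⟩

lemma GeodConvex.mem_interior {A : Set H3} (hA : GeodConvex A) (p : Fin 4 → H3)
    (hp : ∀ i, p i ∈ A) (hli : LinearIndependent ℝ fun i => (p i).1) (c : Fin 4 → ℝ)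
    (hc : ∀ i, 0 < c i) (z : H3) (hz : z.1 = ∑ i, c i • (p i).1) : z ∈ interior A := by
  let b := basisOfLinearIndependentOfCardEqFinrank hli (by simp)
  have hb : ∀ i, b i = (p i).1 := fun i => by simp [b]
  rw [_root_.mem_interior]
  refine ⟨{y | ∀ i, 0 < b.equivFun y.1 i}, fun y hy => ?_, ?_, ?_⟩
  · refine hA.mem_of_sum p Finset.univ (b.equivFun y.1) (fun i _ => hp i) (fun i _ => (hy i).le)
      y ?_
    conv_lhs => rw [← b.sum_equivFun y.1]
    simp only [hb]
  · simp only [Set.ofPred_forall]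
    refine isOpen_iInter_of_finite fun i => ?_
    have : Continuous fun y : H3 => b.equivFun y.1 i :=
      (continuous_apply i).comp (b.equivFun.toLinearMap.continuous_of_finiteDimensional.comp
        continuous_subtype_val)
    exact isOpen_lt continuous_const this
  · intro i
    have : z.1 = ∑ i, c i • b i := by rw [hz]; simp only [hb]
    rw [this, map_sum]
    simpa [Finsupp.single_apply] using hc i

lemma vertex_mem_surface (h : Params C S N) (i : Fin 8) :
    vertex h i ∈ surface hexSusp (vertex h) := by
  rw [mem_surface_iff]
  obtain ⟨b, c, hf⟩ := hexSusp.exists_face i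
  refine ⟨Pi.single i 1, ⟨fun j => ?_, _, hf, fun j hj => ?_⟩, ?_⟩
  · by_cases hj : j = i
    · subst hj; simp
    · simp [hj]
  · have : j ≠ i := fun e => hj (by simp [faceVerts, e])
    simp [this]
  · simp [coneSum, Pi.single_apply]

/-- The vertex `7` is an interior point of the tetrahedron with the vertices `1`, `2`, `3`, `6`: it
lies inside the triangle `0 1 2`, and `0` is the midpoint of the segment from `3` to `6`. -/
lemma vertex_not_convexSurface (h : Params C S N) : ¬ ConvexSurface hexSusp (vertex h) := by
  rintro ⟨A, hA, hcomp, hfr⟩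
  have hsub : ∀ i, vertex h i ∈ A := fun i =>
    hcomp.isClosed.frontier_subset (hfr ▸ vertex_mem_surface h i)
  have h7 : vertex h 7 ∈ frontier A := hfr ▸ vertex_mem_surface h 7
  refine h7.2 ?_
  have hu := h.base_pos
  have hg := h.angle_pos
  have hN := h.N_pos
  have hC := h.C_pos
  have hS := h.S_pos
  have hsq := h.sq_add_sq
  set u := 20 / 99 * C - 8080 / 158301 * S with hu'
  obtain ⟨x, hx, hxe⟩ : ∃ x : ℝ, 0 < x ∧ x * (N * (80 / 1601)) * u =
      80 / 1599 * (20 / 99 * (C ^ 2 - S ^ 2) - 2 * (8080 / 158301) * S * C) :=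
    ⟨80 / 1599 * (20 / 99 * (C ^ 2 - S ^ 2) - 2 * (8080 / 158301) * S * C) /
      (N * (80 / 1601) * u), by positivity, by field_simp⟩
  obtain ⟨y, hy, hye⟩ : ∃ y : ℝ, 0 < y ∧ y * u = 80 / 1599 * S :=
    ⟨80 / 1599 * S / u, by positivity, by field_simp⟩
  refine hA.mem_interior ![vertex h 1, vertex h 2, vertex h 3, vertex h 6] ?_ ?_
    ![x, y, S ^ 2, S ^ 2] ?_ _ ?_
  · intro i
    fin_cases i <;> exact hsub _
  · rw [Fintype.linearIndependent_iff]
    intro g hg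
    have E0 := congrFun hg 0
    have E1 := congrFun hg 1
    have E2 := congrFun hg 2
    have E3 := congrFun hg 3
    simp [Fin.sum_univ_four, vertex, vec] at E0 E1 E2 E3
    have g1 : g 1 = 0 := E2.resolve_right (by linarith)
    have g0 : g 0 = 0 := by
      rw [g1] at E1
      simpa [hN.ne'] using E1
    have g2 : g 2 = 0 := by rw [g1, g0] at E0; linarith
    have g3 : g 3 = 0 := by rw [g1, g0] at E0; linarith
    intro i
    fin_cases i <;> assumption
  · intro i
    fin_cases i <;> simp <;> positivity
  · ext i
    fin_cases i <;> simp [Fin.sum_univ_four, vertex, vec]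
    · refine mul_left_cancel₀ hu.ne' ?_
      rw [hu'] at hxe hye ⊢
      linear_combination (-C * (1601 / 80)) * hxe - 161701 / 158301 * hye +
        (32020 / 158301 * C - 2 * (1601 / 1599) * (20 / 99 * C - 8080 / 158301 * S)) * hsq
    · refine mul_left_cancel₀ hu.ne' ?_
      rw [hu'] at hxe hye ⊢
      linear_combination -hxe - (8080 / 158301 * C + 20 / 99 * S) * hye
    · rw [hu'] at hye
      linear_combination hye

/-! ### The family of polyhedra -/

/-- The sine of the angle `β` at the time `t`. -/
def pathS (t : unitInterval) : ℝ := 7 / 25 + 8 / 25 * t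

/-- The cosine of the angle `β` at the time `t`. -/
def pathC (t : unitInterval) : ℝ := Real.sqrt (1 - pathS t ^ 2)

/-- The normalizing factor of the vertex `1` at the time `t`. -/
def pathN (t : unitInterval) : ℝ := (Real.sqrt (pathC t ^ 2 - (80 / 1601) ^ 2))⁻¹

lemma path_params (t : unitInterval) : Params (pathC t) (pathS t) (pathN t) := by
  have h0 := t.2.1
  have h1 := t.2.2
  have hS : 7 / 25 ≤ pathS t := by unfold pathS; linarith
  have hS' : pathS t ≤ 3 / 5 := by unfold pathS; linarith
  have hC : 4 / 5 ≤ pathC t := Real.le_sqrt_of_sq_le (by nlinarith)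
  have hCC : pathC t ^ 2 = 1 - pathS t ^ 2 := Real.sq_sqrt (by nlinarith)
  have hpos : 0 < pathC t ^ 2 - (80 / 1601) ^ 2 := by nlinarith
  refine ⟨by linarith, hS, hS', hC, inv_pos.2 (Real.sqrt_pos.2 hpos), ?_⟩
  rw [pathN, inv_pow, Real.sq_sqrt hpos.le, inv_mul_cancel₀ hpos.ne']

/-- The deformation. -/
def path (t : unitInterval) : Fin 8 → H3 := vertex (path_params t)

lemma continuous_path : Continuous path := by
  have hS : Continuous pathS := by unfold pathS; fun_prop
  have hC : Continuous pathC := by unfold pathC; fun_prop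
  have hN : Continuous pathN := by
    unfold pathN
    refine Continuous.inv₀ (by fun_prop) fun t => ?_
    exact (inv_pos.1 (path_params t).N_pos).ne'
  refine continuous_pi fun i => Continuous.subtype_mk (continuous_pi fun j => ?_) _
  fin_cases i <;> fin_cases j <;> simp [vec] <;> fun_prop

lemma pathS_injective : Function.Injective pathS := by
  intro s t h
  unfold pathS at h
  exact Subtype.ext (by linarith)

lemma lor_eq_of_hdist_eq {x y x' y' : H3} (h : hdist x y = hdist x' y') :
    lor x.1 y.1 = lor x'.1 y'.1 := by
  have := Real.arcosh_injOn (one_le_neg_lor x y) (one_le_neg_lor x' y') h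
  linarith

lemma path_not_congruent {s t : unitInterval} (hst : s ≠ t) : ¬ Congruent (path s) (path t) := by
  rintro ⟨φ, hφ, h⟩
  have h1 := lor_eq_of_hdist_eq (hφ (path s 4) (path s 7))
  rw [h, h] at h1
  simp [path, vertex, vec, lor] at h1
  have h2 := (path_params s).sq_add_sq
  have h3 := (path_params t).sq_add_sq
  have h4 : pathS s ^ 2 = pathS t ^ 2 := by nlinarith
  exact hst (pathS_injective ((sq_eq_sq₀ (path_params s).S_pos.le (path_params t).S_pos.le).1 h4))

end PolyhedraProperties

section DihedralAngles

open Matrix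

/-! ### Dihedral angles -/

lemma lorAngle_comm (x y : Fin 4 → ℝ) : lorAngle x y = lorAngle y x := by
  rw [lorAngle, lorAngle, lor_comm, mul_comm]

lemma lorAngle_smul {a b : ℝ} (ha : 0 < a) (hb : 0 < b) (x y : Fin 4 → ℝ) :
    lorAngle (a • x) (b • y) = lorAngle x y := by
  have key : ∀ (c : ℝ) (z : Fin 4 → ℝ), 0 < c →
      Real.sqrt (lor (c • z) (c • z)) = c * Real.sqrt (lor z z) := fun c z hc => by
    rw [lor_smul_left, lor_smul_right, ← mul_assoc, Real.sqrt_mul (by positivity),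
      Real.sqrt_mul_self hc.le]
  rw [lorAngle, lorAngle, key _ _ ha, key _ _ hb, lor_smul_left, lor_smul_right]
  congr 1
  rw [show a * (b * lor x y) = (a * b) * lor x y by ring,
    show a * Real.sqrt (lor x x) * (b * Real.sqrt (lor y y)) =
      (a * b) * (Real.sqrt (lor x x) * Real.sqrt (lor y y)) by ring,
    mul_div_mul_left _ _ (by positivity)]

lemma lor_self_pos_of_orthogonal {x : Fin 4 → ℝ} (u : H3) (h : lor x u.1 = 0) (hx : x ≠ 0) :
    0 < lor x x := by
  obtain ⟨u, hu, hu0⟩ := u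
  change lor x u = 0 at h
  simp only [lor] at hu h ⊢
  by_contra hneg
  have h1 : (x 0 * u 0) ^ 2 ≤ (x 1 ^ 2 + x 2 ^ 2 + x 3 ^ 2) * (u 0 ^ 2 - 1) := by
    have e1 : x 0 * u 0 = x 1 * u 1 + x 2 * u 2 + x 3 * u 3 := by linarith
    have e2 : u 0 ^ 2 - 1 = u 1 ^ 2 + u 2 ^ 2 + u 3 ^ 2 := by linarith
    rw [e1, e2]
    nlinarith [sq_nonneg (x 1 * u 2 - x 2 * u 1), sq_nonneg (x 1 * u 3 - x 3 * u 1),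
      sq_nonneg (x 2 * u 3 - x 3 * u 2)]
  have h2 : x 1 ^ 2 + x 2 ^ 2 + x 3 ^ 2 ≤ x 0 ^ 2 := by linarith
  have h3 : 0 ≤ u 0 ^ 2 - 1 := by nlinarith [sq_nonneg (u 1), sq_nonneg (u 2), sq_nonneg (u 3)]
  have h4 : x 0 ^ 2 ≤ 0 := by nlinarith [mul_le_mul_of_nonneg_right h2 h3]
  apply hx
  ext i
  fin_cases i <;> simp <;>
    nlinarith [sq_nonneg (x 0), sq_nonneg (x 1), sq_nonneg (x 2), sq_nonneg (x 3)]

lemma lor_sq_ne_one {u v : H3} (h : u ≠ v) : lor u.1 v.1 ^ 2 ≠ 1 := by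
  intro h1
  have h2 : lor u.1 v.1 = -1 := by nlinarith [one_le_neg_lor u v]
  have h3 := lor_self_pos_of_orthogonal (x := v.1 - u.1) u
    (by rw [lor_sub_left, lor_comm, h2, u.2.1]; ring)
    (fun h0 => h (Subtype.ext (sub_eq_zero.1 h0)).symm)
  rw [lor_sub_left, lor_sub_right, lor_sub_right, lor_comm v.1 u.1, h2, u.2.1, v.2.1] at h3
  norm_num at h3

lemma edgePerp_eq (u v w : H3) : ∃ a b : ℝ, edgePerp u v w = w.1 - (a • u.1 + b • v.1) :=
  ⟨1 / (lor u.1 v.1 ^ 2 - 1) * (lor w.1 u.1 + lor u.1 v.1 * lor w.1 v.1),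
    1 / (lor u.1 v.1 ^ 2 - 1) * (lor w.1 v.1 + lor u.1 v.1 * lor w.1 u.1), by
    rw [edgePerp, smul_add, smul_smul, smul_smul]⟩

lemma lor_edgePerp (u v w : H3) (h : lor u.1 v.1 ^ 2 ≠ 1) :
    lor (edgePerp u v w) u.1 = 0 ∧ lor (edgePerp u v w) v.1 = 0 := by
  have h' : lor u.1 v.1 ^ 2 - 1 ≠ 0 := sub_ne_zero.2 h
  simp only [edgePerp, lor_sub_left, lor_smul_left, lor_add_left, u.2.1, v.2.1, lor_comm v.1 u.1]
  constructor <;> · field_simp; ring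

/-- A vector of the plane of a line which is orthogonal to the line vanishes. -/
lemma edgePerp_unique {u v w : H3} (h : lor u.1 v.1 ^ 2 ≠ 1) {e : Fin 4 → ℝ} {a b : ℝ}
    (he : e = w.1 + (a • u.1 + b • v.1)) (hu : lor e u.1 = 0) (hv : lor e v.1 = 0) :
    edgePerp u v w = e := by
  obtain ⟨a', b', h1⟩ := edgePerp_eq u v w
  obtain ⟨k1, k2⟩ := lor_edgePerp u v w h
  have h' : 1 - lor u.1 v.1 ^ 2 ≠ 0 := sub_ne_zero.2 (Ne.symm h)
  have hd : edgePerp u v w = e + ((-a - a') • u.1 + (-b - b') • v.1) := by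
    rw [h1, he]; module
  rw [hd, lor_add_left, hu, lor_add_left, lor_smul_left, lor_smul_left, u.2.1, lor_comm v.1] at k1
  rw [hd, lor_add_left, hv, lor_add_left, lor_smul_left, lor_smul_left, v.2.1] at k2
  set g := lor u.1 v.1
  have ha : -a - a' = 0 := by
    refine (mul_eq_zero.1 (?_ : (-a - a') * (1 - g ^ 2) = 0)).resolve_right h'
    linear_combination -k1 - g * k2
  have hb : -b - b' = 0 := by
    refine (mul_eq_zero.1 (?_ : (-b - b') * (1 - g ^ 2) = 0)).resolve_right h'
    linear_combination -k2 - g * k1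
  rw [hd, ha, hb]; simp

lemma edgePerp_swap (u v w : H3) : edgePerp v u w = edgePerp u v w := by
  simp only [edgePerp, lor_comm v.1 u.1]
  rw [add_comm ((lor w.1 v.1 + _) • _)]

lemma det4_swap (u v w q : H3) : det4 v u q w = det4 u v w q := by
  have h1 : det4 v u q w = Matrix.det ((Matrix.of ![u.1, v.1, w.1, q.1]).submatrix
      (Equiv.swap 0 1 * Equiv.swap 2 3 : Equiv.Perm (Fin 4)) id) := by
    unfold det4
    congr 1
    ext i j
    fin_cases i <;> rfl
  rw [h1, Matrix.det_permute]
  have : Equiv.Perm.sign (Equiv.swap 0 1 * Equiv.swap 2 3 : Equiv.Perm (Fin 4)) = 1 := by decide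
  rw [this]
  simp [det4]
  rfl

/-- The dihedral angle does not depend on the direction of the edge. -/
lemma dihedralAngle_swap (u v w w' : H3) : dihedralAngle v u w' w = dihedralAngle u v w w' := by
  rw [dihedralAngle, dihedralAngle, det4_swap, edgePerp_swap u v w, edgePerp_swap u v w',
    lorAngle_comm]

/-- The dihedral angle depends only on the plane which contains the edge, with its orientation, and
on the half-spaces which contain the faces; and it is invariant under isometries. -/
lemma dihedralAngle_transport {u v w z u' v' w' z' : H3} (M : Matrix (Fin 4) (Fin 4) ℝ)
    (hM : ∀ x y, lor (M *ᵥ x) (M *ᵥ y) = lor x y) (hdet : M.det = 1)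
    (huv : lor u.1 v.1 ^ 2 ≠ 1) {α β γ δ l a b m c d : ℝ}
    (hu : u'.1 = M *ᵥ (α • u.1 + β • v.1)) (hv : v'.1 = M *ᵥ (γ • u.1 + δ • v.1))
    (hw : w'.1 = M *ᵥ (l • w.1 + (a • u.1 + b • v.1)))
    (hz : z'.1 = M *ᵥ (m • z.1 + (c • u.1 + d • v.1)))
    (hD : 0 < α * δ - β * γ) (hl : 0 < l) (hm : 0 < m) :
    dihedralAngle u' v' w' z' = dihedralAngle u v w z := by
  have hd4 : det4 u' v' w' z' = (α * δ - β * γ) * l * m * det4 u v w z := by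
    have h1 : (Matrix.of ![u'.1, v'.1, w'.1, z'.1] : Matrix (Fin 4) (Fin 4) ℝ) =
        !![α, β, 0, 0; γ, δ, 0, 0; a, b, l, 0; c, d, 0, m] *
          Matrix.of ![u.1, v.1, w.1, z.1] * Mᵀ := by
      ext i j
      fin_cases i <;>
        simp [hu, hv, hw, hz, Matrix.mul_apply, Fin.sum_univ_four, Matrix.mulVec, dotProduct] <;>
        ring
    have h2 : (!![α, β, 0, 0; γ, δ, 0, 0; a, b, l, 0; c, d, 0, m] : Matrix _ _ ℝ).det =
        (α * δ - β * γ) * l * m := by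
      simp [Matrix.det_succ_row_zero, Fin.sum_univ_succ, Fin.succAbove]
      ring
    have h3 := congrArg Matrix.det h1
    rw [Matrix.det_mul, Matrix.det_mul, Matrix.det_transpose, hdet, h2, mul_one] at h3
    exact h3
  have huv' : lor u'.1 v'.1 ^ 2 ≠ 1 := by
    have h1 := u'.2.1
    have h2 := v'.2.1
    have hne : (α * δ - β * γ) ^ 2 * (1 - lor u.1 v.1 ^ 2) ≠ 0 :=
      mul_ne_zero (pow_ne_zero 2 hD.ne') (sub_ne_zero.2 (Ne.symm huv))
    intro h3
    rw [hu, hM] at h1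
    rw [hv, hM] at h2
    rw [hu, hv, hM] at h3
    simp only [lor_add_left, lor_add_right, lor_smul_left, lor_smul_right, u.2.1, v.2.1,
      lor_comm v.1 u.1] at h1 h2 h3
    apply hne
    set g := lor u.1 v.1
    linear_combination (γ * (γ * -1) + δ * (γ * g) + (γ * (δ * g) + δ * (δ * -1))) * h1 - h2 - h3
  have key : ∀ {x x' : H3} {n p q : ℝ}, x'.1 = M *ᵥ (n • x.1 + (p • u.1 + q • v.1)) →
      edgePerp u' v' x' = n • M *ᵥ edgePerp u v x := by
    intro x x' n p q hx
    obtain ⟨s, t, h1⟩ := edgePerp_eq u v x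
    obtain ⟨k1, k2⟩ := lor_edgePerp u v x huv
    set D := α * δ - β * γ
    -- The coefficients express `u` and `v` in terms of the preimages of `u'` and `v'`.
    refine edgePerp_unique huv'
      (a := ((-(n * s) - p) * δ - (-(n * t) - q) * γ) / D)
      (b := ((-(n * t) - q) * α - (-(n * s) - p) * β) / D) ?_ ?_ ?_
    · rw [hx, hu, hv, h1, ← Matrix.mulVec_smul, ← Matrix.mulVec_smul, ← Matrix.mulVec_smul,
        ← Matrix.mulVec_add, ← Matrix.mulVec_add]
      congr 1
      ext i
      simp only [Pi.add_apply, Pi.smul_apply, Pi.sub_apply, smul_eq_mul]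
      have hD' : D ≠ 0 := hD.ne'
      field_simp
      ring
    · rw [hu, lor_smul_left, hM, lor_add_right, lor_smul_right, lor_smul_right, k1, k2]; ring
    · rw [hv, lor_smul_left, hM, lor_add_right, lor_smul_right, lor_smul_right, k1, k2]; ring
  have hang : lorAngle (edgePerp u' v' w') (edgePerp u' v' z') =
      lorAngle (edgePerp u v w) (edgePerp u v z) := by
    rw [key hw, key hz, lorAngle_smul hl hm]
    simp only [lorAngle, hM]
  have hiff : det4 u' v' w' z' ≤ 0 ↔ det4 u v w z ≤ 0 := by
    rw [hd4]
    have : 0 < (α * δ - β * γ) * l * m := by positivity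
    constructor
    · intro h
      by_contra h'
      exact absurd (mul_pos this (not_le.1 h')) (not_lt.2 h)
    · exact fun h => mul_nonpos_of_nonneg_of_nonpos this.le h
  simp only [dihedralAngle, hang, hiff]

lemma dihedralAngle_isometry {u v w z u' v' w' z' : H3} (M : Matrix (Fin 4) (Fin 4) ℝ)
    (hM : ∀ x y, lor (M *ᵥ x) (M *ᵥ y) = lor x y) (hdet : M.det = 1)
    (hu : u'.1 = M *ᵥ u.1) (hv : v'.1 = M *ᵥ v.1) (hw : w'.1 = M *ᵥ w.1) (hz : z'.1 = M *ᵥ z.1) :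
    dihedralAngle u' v' w' z' = dihedralAngle u v w z := by
  have hd4 : det4 u' v' w' z' = det4 u v w z := by
    have h1 : (Matrix.of ![u'.1, v'.1, w'.1, z'.1] : Matrix (Fin 4) (Fin 4) ℝ) =
        Matrix.of ![u.1, v.1, w.1, z.1] * Mᵀ := by
      ext i j
      fin_cases i <;>
        simp [hu, hv, hw, hz, Matrix.mul_apply, Fin.sum_univ_four, Matrix.mulVec, dotProduct] <;>
        ring
    have h3 := congrArg Matrix.det h1
    rwa [Matrix.det_mul, Matrix.det_transpose, hdet, mul_one] at h3
  have key : ∀ {x x' : H3}, x'.1 = M *ᵥ x.1 → edgePerp u' v' x' = M *ᵥ edgePerp u v x := by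
    intro x x' hx
    simp only [edgePerp, hu, hv, hx, hM, Matrix.mulVec_sub, Matrix.mulVec_add, Matrix.mulVec_smul]
  simp only [dihedralAngle, hd4, key hw, key hz, lorAngle, hM]

/-- The dihedral angle between coplanar faces on different sides of the edge is `π`. -/
lemma dihedralAngle_eq_pi {u v w z : H3} (huv : lor u.1 v.1 ^ 2 ≠ 1) {l a b : ℝ} (hl : 0 < l)
    (hz : z.1 = -l • w.1 + (a • u.1 + b • v.1)) (hw : ∀ s t : ℝ, w.1 ≠ s • u.1 + t • v.1) :
    dihedralAngle u v w z = Real.pi := by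
  obtain ⟨s, t, h1⟩ := edgePerp_eq u v w
  obtain ⟨k1, k2⟩ := lor_edgePerp u v w huv
  have he : edgePerp u v z = -l • edgePerp u v w := by
    refine edgePerp_unique huv (a := l * s - a) (b := l * t - b) ?_ ?_ ?_
    · rw [h1, hz]; module
    · rw [lor_smul_left, k1, mul_zero]
    · rw [lor_smul_left, k2, mul_zero]
  have hpos : 0 < lor (edgePerp u v w) (edgePerp u v w) := by
    refine lor_self_pos_of_orthogonal u k1 fun h0 => hw s t ?_
    rw [h1] at h0
    exact sub_eq_zero.1 h0
  have hang : lorAngle (edgePerp u v w) (edgePerp u v z) = Real.pi := by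
    have : -l • edgePerp u v w = l • -edgePerp u v w := by module
    rw [he, this]
    nth_rewrite 1 [← one_smul ℝ (edgePerp u v w)]
    rw [lorAngle_smul one_pos hl, lorAngle, ← neg_one_smul ℝ (edgePerp u v w)]
    simp only [lor_smul_left, lor_smul_right]
    rw [show -1 * (-1 * lor (edgePerp u v w) (edgePerp u v w)) =
      lor (edgePerp u v w) (edgePerp u v w) by ring, Real.mul_self_sqrt hpos.le,
      mul_div_assoc, div_self hpos.ne', mul_one, Real.arccos_neg_one]
  rw [dihedralAngle, hang]
  split_ifs <;> ring

end DihedralAngles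

section ConstantDihedralAngles

open Matrix

/-! ### The dihedral angles of the polyhedra are constant -/

variable {C S N : ℝ}

/-- The rotation about the `x₃`-axis. -/
def rot (C S : ℝ) : Matrix (Fin 4) (Fin 4) ℝ :=
  !![1, 0, 0, 0; 0, C, -S, 0; 0, S, C, 0; 0, 0, 0, 1]

lemma rot_mulVec (C S : ℝ) (x : Fin 4 → ℝ) :
    rot C S *ᵥ x = ![x 0, C * x 1 - S * x 2, S * x 1 + C * x 2, x 3] := by
  ext i
  fin_cases i <;> simp [rot, Matrix.mulVec, dotProduct, Fin.sum_univ_four]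
  ring

lemma Params.lor_rot (h : Params C S N) (x y : Fin 4 → ℝ) :
    lor (rot C S *ᵥ x) (rot C S *ᵥ y) = lor x y := by
  simp only [rot_mulVec, lor, Matrix.cons_val]
  linear_combination (x 1 * y 1 + x 2 * y 2) * h.sq_add_sq

lemma Params.det_rot (h : Params C S N) : (rot C S).det = 1 := by
  simp [rot, Matrix.det_succ_row_zero, Fin.sum_univ_succ, Fin.succAbove]
  linear_combination h.sq_add_sq

/-- The half-turn about the `x₁`-axis. -/
def halfTurn : Matrix (Fin 4) (Fin 4) ℝ :=
  !![1, 0, 0, 0; 0, 1, 0, 0; 0, 0, -1, 0; 0, 0, 0, -1]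

lemma halfTurn_mulVec (x : Fin 4 → ℝ) : halfTurn *ᵥ x = ![x 0, x 1, -x 2, -x 3] := by
  ext i
  fin_cases i <;> simp [halfTurn, Matrix.mulVec, dotProduct, Fin.sum_univ_four]

lemma lor_halfTurn (x y : Fin 4 → ℝ) : lor (halfTurn *ᵥ x) (halfTurn *ᵥ y) = lor x y := by
  simp only [halfTurn_mulVec, lor, Matrix.cons_val]
  ring

lemma det_halfTurn : halfTurn.det = 1 := by
  simp [halfTurn, Matrix.det_succ_row_zero, Fin.sum_univ_succ, Fin.succAbove]

lemma vertex_hexFlip (h : Params C S N) (i : Fin 8) :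
    (vertex h (hexFlip i)).1 = halfTurn *ᵥ (vertex h i).1 := by
  rw [halfTurn_mulVec]
  ext j
  fin_cases i <;> fin_cases j <;> simp [hexFlip, vertex, vec]

/-- The vertices of the tetrahedron `0 2 3 4` before the rotation by the angle `β` (the points `0`,
`1`, `2`, `3`), and two points on the other side of its walls through the edges `0 4` and `2 4`
(the points `4` and `5`). -/
def refVec : Fin 6 → Fin 4 → ℝ :=
  ![![1, 0, 0, 0], ![1601 / 1599, 0, 0, 80 / 1599],
    ![161701 / 158301, 8080 / 158301, -(20 / 99), 0], ![1601 / 1599, 80 / 1599, 0, 0],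
    ![161701 / 158301, 8080 / 158301, 20 / 99, 0], ![5 / 4, 3 / 4, 0, 0]]

/-- `refVec` as points of hyperbolic space. -/
def refPt (i : Fin 6) : H3 :=
  ⟨refVec i, by fin_cases i <;> simp [refVec, lor] <;> norm_num⟩

/-- A vector of the rotated configuration is given by its coordinates. -/
lemma eq_rot_mulVec {x y : Fin 4 → ℝ} (h0 : x 0 = y 0) (h1 : x 1 = C * y 1 - S * y 2)
    (h2 : x 2 = S * y 1 + C * y 2) (h3 : x 3 = y 3) : x = rot C S *ᵥ y := by
  rw [rot_mulVec]
  ext i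
  fin_cases i <;> assumption

lemma vec_zero (C S N : ℝ) : vec C S N 0 = rot C S *ᵥ refVec 0 := by
  apply eq_rot_mulVec <;> simp [vec, refVec]

lemma vec_three (C S N : ℝ) : vec C S N 3 = rot C S *ᵥ refVec 1 := by
  apply eq_rot_mulVec <;> simp [vec, refVec]

lemma vec_two (C S N : ℝ) : vec C S N 2 = rot C S *ᵥ refVec 2 := by
  apply eq_rot_mulVec <;> simp [vec, refVec] <;> ring

lemma vec_four (C S N : ℝ) : vec C S N 4 = rot C S *ᵥ refVec 3 := by
  apply eq_rot_mulVec <;> simp [vec, refVec] <;> ring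

lemma Params.vec_one (h : Params C S N) : vec C S N 1 = rot C S *ᵥ
    ((N * (C - 404 / 1599 * S) * (1599 / 1601)) • refVec 3 + (396 / 1601 * N * S) • refVec 2) := by
  have hsq := h.sq_add_sq
  apply eq_rot_mulVec <;> simp [vec, refVec]
  · ring
  · linear_combination -(N * (80 / 1601)) * hsq
  · ring

/-- The vertex `7` lies inside the base of the tetrahedron `0 2 3 4`. -/
lemma Params.vec_seven (h : Params C S N) : vec C S N 7 = rot C S *ᵥ
    ((C ^ 2 - S ^ 2 - 2 * (404 / 1599) * S * C) • refVec 3 +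
      ((2 * S ^ 2 * (1601 / 1599)) • refVec 0 + (792 / 1599 * S * C) • refVec 2)) := by
  have hsq := h.sq_add_sq
  apply eq_rot_mulVec <;> simp [vec, refVec]
  · linear_combination (-(1601 / 1599)) * hsq
  · linear_combination -(80 / 1599 * C) * hsq
  · linear_combination (80 / 1599 * S) * hsq

lemma Params.vec_five (h : Params C S N) : vec C S N 5 = rot C S *ᵥ
    ![161701 / 158301, 8080 / 158301 * (C ^ 2 - S ^ 2) + 2 * (20 / 99) * S * C,
      20 / 99 * (C ^ 2 - S ^ 2) - 2 * (8080 / 158301) * S * C, 0] := by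
  have hsq := h.sq_add_sq
  apply eq_rot_mulVec <;> simp [vec]
  · linear_combination -(8080 / 158301 * C + 20 / 99 * S) * hsq
  · linear_combination (8080 / 158301 * S - 20 / 99 * C) * hsq

lemma Params.vec_five_eq_refVec_four (h : Params C S N) : ∃ c d : ℝ, vec C S N 5 = rot C S *ᵥ
    ((C ^ 2 - S ^ 2 - 2 * (404 / 1599) * S * C) • refVec 4 + (c • refVec 0 + d • refVec 3)) := by
  rw [h.vec_five]
  refine ⟨161701 / 158301 * (1 - (C ^ 2 - S ^ 2 - 2 * (404 / 1599) * S * C)) -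
    2 * S * C * (1599 / 396 + 404 * 101 / (1599 * 99)) * (1601 / 1599),
    2 * S * C * (1599 / 396 + 404 * 101 / (1599 * 99)), ?_⟩
  congr 1
  ext i
  fin_cases i <;> simp [refVec] <;> ring

lemma Params.vec_five_eq_refVec_five (h : Params C S N) : ∃ m c d : ℝ, 0 < m ∧
    vec C S N 5 = rot C S *ᵥ (m • refVec 5 + (c • refVec 2 + d • refVec 3)) := by
  have hu := h.base_pos
  have hS := h.S_pos
  have hsq := h.sq_add_sq
  rw [h.vec_five]
  refine ⟨2 * S * (20 / 99 * C - 8080 / 158301 * S) * (6404 / 4403),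
    -(C ^ 2 - S ^ 2 - 2 * (404 / 1599) * S * C),
    (161701 / 158301 * (1 + (C ^ 2 - S ^ 2 - 2 * (404 / 1599) * S * C)) -
      2 * S * (20 / 99 * C - 8080 / 158301 * S) * (6404 / 4403) * (5 / 4)) * (1599 / 1601),
    by positivity, ?_⟩
  congr 1
  ext i
  fin_cases i <;> simp [refVec]
  · ring
  · linear_combination 8080 / 158301 * hsq
  · ring

lemma Params.pos_of_angle (h : Params C S N) : 0 < C ^ 2 - S ^ 2 - 2 * (404 / 1599) * S * C := by
  linarith [h.angle_pos]

lemma Params.pos_of_base (h : Params C S N) : 0 < C - 404 / 1599 * S := by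
  linarith [h.base_pos]

lemma lor_refVec_sq_ne {u v : Fin 6} (h : u ≠ v) : lor (refVec u) (refVec v) ^ 2 ≠ 1 :=
  lor_sq_ne_one (u := refPt u) (v := refPt v) fun e => h (by
    have e' : refVec u = refVec v := congrArg Subtype.val e
    have e0 := congrFun e' 0
    have e1 := congrFun e' 1
    have e2 := congrFun e' 2
    revert e0 e1 e2
    fin_cases u <;> fin_cases v <;> simp [refVec] <;> norm_num)

lemma dihedralAngle_vertex_ref (h : Params C S N) {u' v' w' z' : Fin 8} {u v w z : Fin 6}
    (huv : lor (refVec u) (refVec v) ^ 2 ≠ 1) (α β γ δ l a b m c d : ℝ)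
    (hu : vec C S N u' = rot C S *ᵥ (α • refVec u + β • refVec v))
    (hv : vec C S N v' = rot C S *ᵥ (γ • refVec u + δ • refVec v))
    (hw : vec C S N w' = rot C S *ᵥ (l • refVec w + (a • refVec u + b • refVec v)))
    (hz : vec C S N z' = rot C S *ᵥ (m • refVec z + (c • refVec u + d • refVec v)))
    (hD : 0 < α * δ - β * γ) (hl : 0 < l) (hm : 0 < m) :
    dihedralAngle (vertex h u') (vertex h v') (vertex h w') (vertex h z') =
      dihedralAngle (refPt u) (refPt v) (refPt w) (refPt z) :=
  dihedralAngle_transport (rot C S) h.lor_rot h.det_rot huv hu hv hw hz hD hl hm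

/-- At the edge `0 2` the face `0 7 2` lies in the base `0 2 4` of the tetrahedron, so that
the dihedral angle is that of the tetrahedron. -/
lemma dihedralAngle_023 (h : Params C S N) :
    dihedralAngle (vertex h 0) (vertex h 2) (vertex h 3) (vertex h 7) =
      dihedralAngle (refPt 0) (refPt 2) (refPt 1) (refPt 3) :=
  dihedralAngle_vertex_ref h (lor_refVec_sq_ne (by decide)) 1 0 0 1 1 0 0 _ _ _
    (by simp [vec_zero]) (by simp [vec_two]) (by simp [vec_three]) h.vec_seven (by norm_num)
    one_pos h.pos_of_angle

lemma dihedralAngle_034 (h : Params C S N) :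
    dihedralAngle (vertex h 0) (vertex h 3) (vertex h 4) (vertex h 2) =
      dihedralAngle (refPt 0) (refPt 1) (refPt 3) (refPt 2) :=
  dihedralAngle_vertex_ref h (lor_refVec_sq_ne (by decide)) 1 0 0 1 1 0 0 1 0 0
    (by simp [vec_zero]) (by simp [vec_three]) (by simp [vec_four]) (by simp [vec_two])
    (by norm_num) one_pos one_pos

/-- The edge `0 4` lies in the base of the other tetrahedron, so that the faces are a wall of
the tetrahedron `0 2 3 4` and the continuation of its base. -/
lemma dihedralAngle_045 (h : Params C S N) :
    dihedralAngle (vertex h 0) (vertex h 4) (vertex h 5) (vertex h 3) =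
      dihedralAngle (refPt 0) (refPt 3) (refPt 4) (refPt 1) := by
  obtain ⟨c, d, e⟩ := h.vec_five_eq_refVec_four
  exact dihedralAngle_vertex_ref h (lor_refVec_sq_ne (by decide)) 1 0 0 1 _ _ _ 1 0 0
    (by simp [vec_zero]) (by simp [vec_four]) e (by simp [vec_three]) (by norm_num)
    h.pos_of_angle one_pos

lemma dihedralAngle_127 (h : Params C S N) :
    dihedralAngle (vertex h 1) (vertex h 2) (vertex h 7) (vertex h 3) =
      dihedralAngle (refPt 3) (refPt 2) (refPt 0) (refPt 1) := by
  have hN := h.N_pos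
  have hS := h.S_pos
  have hu := h.pos_of_base
  exact dihedralAngle_vertex_ref h (lor_refVec_sq_ne (by decide)) _ _ 0 1
    (2 * S ^ 2 * (1601 / 1599)) (C ^ 2 - S ^ 2 - 2 * (404 / 1599) * S * C) (792 / 1599 * S * C)
    1 0 0 h.vec_one (by simp [vec_two]) (by rw [h.vec_seven]; congr 1; module)
    (by simp [vec_three]) (by simp; positivity) (by positivity) one_pos

lemma dihedralAngle_143 (h : Params C S N) :
    dihedralAngle (vertex h 1) (vertex h 4) (vertex h 3) (vertex h 5) =
      dihedralAngle (refPt 2) (refPt 3) (refPt 1) (refPt 5) := by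
  have hN := h.N_pos
  have hS := h.S_pos
  obtain ⟨m, c, d, hm, e⟩ := h.vec_five_eq_refVec_five
  exact dihedralAngle_vertex_ref h (lor_refVec_sq_ne (by decide))
    (396 / 1601 * N * S) (N * (C - 404 / 1599 * S) * (1599 / 1601)) 0 1 1 0 0 _ _ _
    (by rw [h.vec_one, add_comm]) (by simp [vec_four]) (by simp [vec_three]) e (by simp; positivity)
    one_pos hm

lemma dihedralAngle_230 (h : Params C S N) :
    dihedralAngle (vertex h 2) (vertex h 3) (vertex h 0) (vertex h 1) =
      dihedralAngle (refPt 2) (refPt 1) (refPt 0) (refPt 3) := by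
  have hN := h.N_pos
  have hu := h.pos_of_base
  exact dihedralAngle_vertex_ref h (lor_refVec_sq_ne (by decide)) 1 0 0 1 1 0 0
    (N * (C - 404 / 1599 * S) * (1599 / 1601)) (396 / 1601 * N * S) 0
    (by simp [vec_two]) (by simp [vec_three]) (by simp [vec_zero]) (by rw [h.vec_one]; simp)
    (by norm_num) one_pos (by positivity)

lemma dihedralAngle_340 (h : Params C S N) :
    dihedralAngle (vertex h 3) (vertex h 4) (vertex h 0) (vertex h 1) =
      dihedralAngle (refPt 1) (refPt 3) (refPt 0) (refPt 2) := by
  have hN := h.N_pos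
  have hS := h.S_pos
  exact dihedralAngle_vertex_ref h (lor_refVec_sq_ne (by decide)) 1 0 0 1 1 0 0
    (396 / 1601 * N * S) 0 (N * (C - 404 / 1599 * S) * (1599 / 1601))
    (by simp [vec_three]) (by simp [vec_four]) (by simp [vec_zero])
    (by rw [h.vec_one, add_comm]; simp) (by norm_num) one_pos (by positivity)

/-- The edge from `1` to `3` divides the face `2 3 4` of a tetrahedron. -/
lemma dihedralAngle_132 (h : Params C S N) :
    dihedralAngle (vertex h 1) (vertex h 3) (vertex h 2) (vertex h 4) = Real.pi := by
  have hN := h.N_pos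
  have hS := h.S_pos
  have hC := h.C_pos
  have hu := h.pos_of_base
  have hb := h.base_pos
  have hx : 0 < N * (C - 404 / 1599 * S) * (1599 / 1601) := by positivity
  refine dihedralAngle_eq_pi ?_
    (l := (396 / 1601 * N * S) / (N * (C - 404 / 1599 * S) * (1599 / 1601)))
    (a := 1 / (N * (C - 404 / 1599 * S) * (1599 / 1601))) (b := 0) (by positivity) ?_ ?_
  · refine lor_sq_ne_one fun e => ?_
    have := congrFun (congrArg Subtype.val e) 3
    simp [vertex, vec] at this
    norm_num at this
  · change vec C S N 4 = _ • vec C S N 2 + (_ • vec C S N 1 + _ • _)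
    rw [h.vec_one, Matrix.mulVec_add, Matrix.mulVec_smul, Matrix.mulVec_smul, ← vec_four C S N,
      ← vec_two C S N]
    set α := N * (C - 404 / 1599 * S) * (1599 / 1601)
    rw [smul_add, smul_smul, one_div, inv_mul_cancel₀ hx.ne', smul_smul, div_eq_mul_inv]
    module
  · intro s t e
    have := congrFun e 2
    simp [vertex, vec] at this
    linarith

/-- The edge from `4` to `5` divides the face with the vertices `0`, `4`, `1`, `5`. -/
lemma dihedralAngle_450 (h : Params C S N) :
    dihedralAngle (vertex h 4) (vertex h 5) (vertex h 0) (vertex h 1) = Real.pi := by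
  have hN := h.N_pos
  have hS := h.S_pos
  have hC := h.C_pos
  have hu := h.pos_of_base
  have hg := h.pos_of_angle
  set α := N * (C - 404 / 1599 * S) * (1599 / 1601) with hα
  set g := C ^ 2 - S ^ 2 - 2 * (404 / 1599) * S * C with hg'
  have hx : 0 < α := by positivity
  -- The vertices `0`, `1`, `2`, `7` are coplanar.
  obtain ⟨y, hy⟩ : ∃ y : ℝ, vec C S N 7 =
      (g / α) • vec C S N 1 + ((2 * S ^ 2 * (1601 / 1599)) • vec C S N 0 + y • vec C S N 2) := by
    refine ⟨792 / 1599 * S * C - g / α * (396 / 1601 * N * S), ?_⟩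
    rw [h.vec_one, h.vec_seven, Matrix.mulVec_add, Matrix.mulVec_add, Matrix.mulVec_add,
      Matrix.mulVec_smul, Matrix.mulVec_smul, Matrix.mulVec_smul, Matrix.mulVec_smul,
      Matrix.mulVec_smul, ← vec_zero C S N, ← vec_four C S N, ← vec_two C S N, ← hα, ← hg',
      smul_add, smul_smul, div_mul_cancel₀ _ hx.ne']
    module
  have hy' : vec C S N 4 =
      (g / α) • vec C S N 1 + ((2 * S ^ 2 * (1601 / 1599)) • vec C S N 0 + y • vec C S N 5) := by
    have := congrArg (halfTurn *ᵥ ·) hy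
    simp only [Matrix.mulVec_add, Matrix.mulVec_smul] at this
    simpa [vertex, hexFlip] using ((vertex_hexFlip h 7).trans this).trans (by
      rw [← show _ = halfTurn *ᵥ vec C S N 1 from vertex_hexFlip h 1,
        ← show _ = halfTurn *ᵥ vec C S N 0 from vertex_hexFlip h 0,
        ← show _ = halfTurn *ᵥ vec C S N 2 from vertex_hexFlip h 2]
      rfl)
  refine dihedralAngle_eq_pi ?_ (l := 2 * S ^ 2 * (1601 / 1599) * (α / g)) (a := α / g)
    (b := -(y * (α / g))) (by positivity) ?_ ?_
  · refine lor_sq_ne_one fun e => ?_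
    have := congrFun (congrArg Subtype.val e) 0
    simp [vertex, vec] at this
    norm_num at this
  · change vec C S N 1 = _ • vec C S N 0 + (_ • vec C S N 4 + _ • vec C S N 5)
    rw [hy', smul_add, smul_smul, div_mul_div_comm, mul_comm α g, div_self (by positivity)]
    module
  · intro s t e
    have e0 := congrFun e 0
    have e1 := congrFun e 1
    have e2 := congrFun e 2
    simp [vertex, vec] at e0 e1 e2
    have hb := h.angle_pos
    have ht : t = 0 := by
      refine (mul_eq_zero.1 (?_ : t * (20 / 99 * (C ^ 2 - S ^ 2) - 2 * (8080 / 158301) * S * C) =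
        0)).resolve_right hb.ne'
      linear_combination S * e1 - C * e2
    rw [ht] at e0 e1
    have hs : s = 0 := by simpa [hC.ne'] using e1
    rw [hs] at e0
    norm_num at e0

/-- All dihedral angles are constant. -/
lemma dihedralAngle_vertex_eq {C' S' N' : ℝ} (h : Params C S N) (h' : Params C' S' N') :
    ∀ a b c d, hexSusp.IsHinge a b c d →
      dihedralAngle (vertex h a) (vertex h b) (vertex h c) (vertex h d) =
        dihedralAngle (vertex h' a) (vertex h' b) (vertex h' c) (vertex h' d) := by
  refine hexSusp_hinge_induction ?_ ?_ ?_ ?_ ?_ ?_ ?_ ?_ ?_ ?_ ?_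
  · intro a b c d e
    rw [dihedralAngle_swap (vertex h a), dihedralAngle_swap (vertex h' a), e]
  · intro a b c d e
    rw [dihedralAngle_isometry halfTurn lor_halfTurn det_halfTurn (vertex_hexFlip h a)
      (vertex_hexFlip h b) (vertex_hexFlip h c) (vertex_hexFlip h d),
      dihedralAngle_isometry halfTurn lor_halfTurn det_halfTurn (vertex_hexFlip h' a)
      (vertex_hexFlip h' b) (vertex_hexFlip h' c) (vertex_hexFlip h' d), e]
  · rw [dihedralAngle_023, dihedralAngle_023]
  · rw [dihedralAngle_034, dihedralAngle_034]
  · rw [dihedralAngle_045, dihedralAngle_045]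
  · rw [dihedralAngle_127, dihedralAngle_127]
  · rw [dihedralAngle_132, dihedralAngle_132]
  · rw [dihedralAngle_143, dihedralAngle_143]
  · rw [dihedralAngle_230, dihedralAngle_230]
  · rw [dihedralAngle_340, dihedralAngle_340]
  · rw [dihedralAngle_450, dihedralAngle_450]

end ConstantDihedralAngles

section Curvature

open Matrix

variable {C S N : ℝ}

/-! ### The ends of the path -/

lemma pathS_zero : pathS 0 = 7 / 25 := by simp [pathS]

lemma pathS_one : pathS 1 = 3 / 5 := by norm_num [pathS]

lemma pathC_zero : pathC 0 = 24 / 25 := by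
  rw [pathC, pathS_zero, Real.sqrt_eq_iff_mul_self_eq] <;> norm_num

lemma pathC_one : pathC 1 = 4 / 5 := by
  rw [pathC, pathS_one, Real.sqrt_eq_iff_mul_self_eq] <;> norm_num

lemma params_zero : Params (24 / 25) (7 / 25) (pathN 0) := by
  have := path_params 0
  rwa [pathS_zero, pathC_zero] at this

lemma params_one : Params (4 / 5) (3 / 5) (pathN 1) := by
  have := path_params 1
  rwa [pathS_one, pathC_one] at this

lemma path_zero : path 0 = vertex params_zero := by
  ext i j
  simp only [path, vertex, pathS_zero, pathC_zero]

lemma path_one : path 1 = vertex params_one := by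
  ext i j
  simp only [path, vertex, pathS_one, pathC_one]

lemma pathN_zero_bounds : 10430 / 10000 ≤ pathN 0 ∧ pathN 0 ≤ 10432 / 10000 := by
  have h1 := params_zero.N_sq
  have h2 := params_zero.N_pos
  constructor
  · by_contra h; push Not at h; nlinarith
  · by_contra h; push Not at h; nlinarith

lemma pathN_one_bounds : 12524 / 10000 ≤ pathN 1 ∧ pathN 1 ≤ 12525 / 10000 := by
  have h1 := params_one.N_sq
  have h2 := params_one.N_pos
  constructor
  · by_contra h; push Not at h; nlinarith
  · by_contra h; push Not at h; nlinarith

/-! ### The Gauss curvature -/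

lemma planeAngle_origin {p v w : H3} (hp : p.1 = ![1, 0, 0, 0]) : planeAngle p v w =
    Real.arccos ((v.1 1 * w.1 1 + v.1 2 * w.1 2 + v.1 3 * w.1 3) /
      (Real.sqrt (v.1 1 ^ 2 + v.1 2 ^ 2 + v.1 3 ^ 2) *
        Real.sqrt (w.1 1 ^ 2 + w.1 2 ^ 2 + w.1 3 ^ 2))) := by
  have key : ∀ v w : H3, lor (dirTo p v) (dirTo p w) =
      v.1 1 * w.1 1 + v.1 2 * w.1 2 + v.1 3 * w.1 3 := by
    intro v w
    simp [dirTo, hp, lor]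
  simp only [planeAngle, lorAngle, key, sq]

/-- At the vertex `0` all angles but those at `0` in the triangles `0 4 5` and `0 7 2` are
right angles. -/
lemma gaussCurvature_vertex_zero (h : Params C S N) : gaussCurvature hexSusp (vertex h) 0 =
    -2 * Real.arccos (80 / 1599 * (8080 / 158301 * (C ^ 2 - S ^ 2) + 2 * (20 / 99) * S * C) /
      (Real.sqrt ((80 / 1599) ^ 2) * Real.sqrt ((8080 / 158301) ^ 2 + (20 / 99) ^ 2))) := by
  have hsq := h.sq_add_sq
  have hf : hexSusp.faces.filter (fun f => f.1 = 0) =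
      {(0, 2, 3), (0, 3, 4), (0, 4, 5), (0, 5, 6), (0, 6, 7), (0, 7, 2)} := by decide +kernel
  have h0 : (vertex h 0).1 = ![1, 0, 0, 0] := by simp [vertex, vec]
  have n1 : (80 / 1599 * C) ^ 2 + (80 / 1599 * S) ^ 2 = (80 / 1599) ^ 2 := by
    linear_combination (80 / 1599) ^ 2 * hsq
  have n2 : (8080 / 158301 * C + 20 / 99 * S) ^ 2 + (20 / 99 * C - 8080 / 158301 * S) ^ 2 =
      (8080 / 158301) ^ 2 + (20 / 99) ^ 2 := by
    linear_combination ((8080 / 158301) ^ 2 + (20 / 99) ^ 2) * hsq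
  have n3 : (8080 / 158301 * C + 20 / 99 * S) ^ 2 + (8080 / 158301 * S - 20 / 99 * C) ^ 2 =
      (8080 / 158301) ^ 2 + (20 / 99) ^ 2 := by
    linear_combination ((8080 / 158301) ^ 2 + (20 / 99) ^ 2) * hsq
  have e1 : planeAngle (vertex h 0) (vertex h 2) (vertex h 3) = Real.pi / 2 := by
    rw [planeAngle_origin h0]; simp [vertex, vec]
  have e2 : planeAngle (vertex h 0) (vertex h 3) (vertex h 4) = Real.pi / 2 := by
    rw [planeAngle_origin h0]; simp [vertex, vec]
  have e4 : planeAngle (vertex h 0) (vertex h 5) (vertex h 6) = Real.pi / 2 := by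
    rw [planeAngle_origin h0]; simp [vertex, vec]
  have e5 : planeAngle (vertex h 0) (vertex h 6) (vertex h 7) = Real.pi / 2 := by
    rw [planeAngle_origin h0]; simp [vertex, vec]
  have e3 : planeAngle (vertex h 0) (vertex h 4) (vertex h 5) =
      Real.arccos (80 / 1599 * (8080 / 158301 * (C ^ 2 - S ^ 2) + 2 * (20 / 99) * S * C) /
      (Real.sqrt ((80 / 1599) ^ 2) * Real.sqrt ((8080 / 158301) ^ 2 + (20 / 99) ^ 2))) := by
    rw [planeAngle_origin h0, ← n1, ← n2]
    congr 1
    simp [vertex, vec]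
    congr 1
    ring
  have e6 : planeAngle (vertex h 0) (vertex h 7) (vertex h 2) =
      Real.arccos (80 / 1599 * (8080 / 158301 * (C ^ 2 - S ^ 2) + 2 * (20 / 99) * S * C) /
      (Real.sqrt ((80 / 1599) ^ 2) * Real.sqrt ((8080 / 158301) ^ 2 + (20 / 99) ^ 2))) := by
    rw [planeAngle_origin h0, ← n1, ← n3]
    congr 1
    simp [vertex, vec]
    congr 1
    ring
  rw [gaussCurvature, hf]
  rw [Finset.sum_insert (by decide), Finset.sum_insert (by decide), Finset.sum_insert (by decide),
    Finset.sum_insert (by decide), Finset.sum_insert (by decide), Finset.sum_singleton]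
  rw [e1, e2, e3, e4, e5, e6]
  ring

lemma gaussCurvature_path_ne :
    gaussCurvature hexSusp (path 0) 0 ≠ gaussCurvature hexSusp (path 1) 0 := by
  rw [path_zero, path_one, gaussCurvature_vertex_zero, gaussCurvature_vertex_zero]
  intro h
  have h1 : Real.sqrt ((80 / 1599) ^ 2) = 80 / 1599 := Real.sqrt_sq (by norm_num)
  have h2 : 2083 / 10000 ≤ Real.sqrt ((8080 / 158301) ^ 2 + (20 / 99) ^ 2) :=
    Real.le_sqrt_of_sq_le (by norm_num)
  set K := Real.sqrt ((8080 / 158301) ^ 2 + (20 / 99) ^ 2)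
  rw [h1] at h
  have hK : 0 < 80 / 1599 * K := by positivity
  have h3 := @Real.arccos_injOn _ ?_ _ ?_ (mul_left_cancel₀ (by norm_num) h)
  · rw [div_left_inj' hK.ne'] at h3
    norm_num at h3
  · rw [Set.mem_Icc, le_div_iff₀ hK, div_le_iff₀ hK]
    constructor <;> linarith
  · rw [Set.mem_Icc, le_div_iff₀ hK, div_le_iff₀ hK]
    constructor <;> nlinarith

/-! ### The total mean curvature -/

lemma det4_eq (u v w q : H3) : det4 u v w q =
    u.1 0 * (v.1 1 * (w.1 2 * q.1 3 - w.1 3 * q.1 2) - v.1 2 * (w.1 1 * q.1 3 - w.1 3 * q.1 1) +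
      v.1 3 * (w.1 1 * q.1 2 - w.1 2 * q.1 1)) -
    u.1 1 * (v.1 0 * (w.1 2 * q.1 3 - w.1 3 * q.1 2) - v.1 2 * (w.1 0 * q.1 3 - w.1 3 * q.1 0) +
      v.1 3 * (w.1 0 * q.1 2 - w.1 2 * q.1 0)) +
    u.1 2 * (v.1 0 * (w.1 1 * q.1 3 - w.1 3 * q.1 1) - v.1 1 * (w.1 0 * q.1 3 - w.1 3 * q.1 0) +
      v.1 3 * (w.1 0 * q.1 1 - w.1 1 * q.1 0)) -
    u.1 3 * (v.1 0 * (w.1 1 * q.1 2 - w.1 2 * q.1 1) - v.1 1 * (w.1 0 * q.1 2 - w.1 2 * q.1 0) +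
      v.1 2 * (w.1 0 * q.1 1 - w.1 1 * q.1 0)) := by
  have e : (![u.1, v.1, w.1, q.1] : Matrix (Fin 4) (Fin 4) ℝ) =
      !![u.1 0, u.1 1, u.1 2, u.1 3; v.1 0, v.1 1, v.1 2, v.1 3; w.1 0, w.1 1, w.1 2, w.1 3;
        q.1 0, q.1 1, q.1 2, q.1 3] := by
    ext i j
    fin_cases i <;> fin_cases j <;> rfl
  refine (congrArg Matrix.det e).trans ?_
  simp [Matrix.det_succ_row_zero, Fin.sum_univ_succ, Fin.succAbove]
  ring

/-- The dihedral angle of a tetrahedron at the edge `2 4` is acute. -/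
lemma dihedralAngle_127_lt (h : Params C S N) :
    dihedralAngle (vertex h 1) (vertex h 2) (vertex h 7) (vertex h 3) < Real.pi := by
  rw [dihedralAngle_127, dihedralAngle, if_pos (by
    rw [det4_eq]; simp [refPt, refVec]; norm_num)]
  have h0 : lor (refPt 3).1 (refPt 2).1 ^ 2 ≠ 1 := lor_refVec_sq_ne (u := 3) (v := 2) (by decide)
  have h1 : edgePerp (refPt 3) (refPt 2) (refPt 0) =
      (refPt 0).1 + (-(1601 / 1599 : ℝ) • (refPt 3).1 + (0 : ℝ) • (refPt 2).1) := by
    refine edgePerp_unique h0 rfl ?_ ?_ <;>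
      simp [lor, refPt, refVec] <;> norm_num
  have h2 : edgePerp (refPt 3) (refPt 2) (refPt 1) =
      (refPt 1).1 + (-(1601 / 1599 * (1601 / 1599) : ℝ) • (refPt 3).1 +
        (0 : ℝ) • (refPt 2).1) := by
    refine edgePerp_unique h0 rfl ?_ ?_ <;>
      simp [lor, refPt, refVec] <;> norm_num
  have h3 : 0 ≤ lor (edgePerp (refPt 3) (refPt 2) (refPt 0))
      (edgePerp (refPt 3) (refPt 2) (refPt 1)) := by
    rw [h1, h2]
    simp [lor, refPt, refVec]
    norm_num
  have h4 : lorAngle (edgePerp (refPt 3) (refPt 2) (refPt 0))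
      (edgePerp (refPt 3) (refPt 2) (refPt 1)) ≤ Real.pi / 2 :=
    Real.arccos_le_pi_div_two.2 (by positivity)
  linarith [Real.pi_pos]

lemma le_dihedralAngle_143 (h : Params C S N) :
    Real.pi ≤ dihedralAngle (vertex h 1) (vertex h 4) (vertex h 3) (vertex h 5) := by
  rw [dihedralAngle_143, dihedralAngle, if_neg (by
    rw [det4_eq]; simp [refPt, refVec]; norm_num)]
  have : lorAngle (edgePerp (refPt 2) (refPt 3) (refPt 1))
      (edgePerp (refPt 2) (refPt 3) (refPt 5)) ≤ Real.pi := Real.arccos_le_pi _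
  linarith

lemma hdist_lt_hdist {x y x' y' : H3} (h : -lor x.1 y.1 < -lor x'.1 y'.1) :
    hdist x y < hdist x' y' :=
  (Real.arcosh_lt_arcosh (by linarith [one_le_neg_lor x y])
    (by linarith [one_le_neg_lor x' y'])).2 h

lemma hdist_comm (x y : H3) : hdist x y = hdist y x := by
  rw [hdist, hdist, lor_comm]

lemma hdist_hexFlip (h : Params C S N) (i j : Fin 8) :
    hdist (vertex h (hexFlip i)) (vertex h (hexFlip j)) = hdist (vertex h i) (vertex h j) := by
  rw [hdist, hdist, vertex_hexFlip, vertex_hexFlip, lor_halfTurn]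

/-- The vertex `1` moves towards the vertex `2`. -/
lemma hdist_path_one_two :
    hdist (vertex params_one 1) (vertex params_one 2) <
      hdist (vertex params_zero 1) (vertex params_zero 2) := by
  apply hdist_lt_hdist
  have h0 := pathN_zero_bounds
  have h1 := pathN_one_bounds
  simp [vertex, vec, lor]
  linarith

/-- The vertex `1` moves away from the vertex `4`. -/
lemma hdist_path_one_four :
    hdist (vertex params_zero 1) (vertex params_zero 4) <
      hdist (vertex params_one 1) (vertex params_one 4) := by
  apply hdist_lt_hdist
  have k0 := pathN_zero_bounds
  have k1 := pathN_one_bounds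
  simp [vertex, vec, lor]
  linarith

lemma totalMeanCurvature_path_lt :
    totalMeanCurvature hexSusp (path 1) < totalMeanCurvature hexSusp (path 0) := by
  rw [path_zero, path_one]
  have hconst : ∀ i j, (lor (vec (4 / 5) (3 / 5) (pathN 1) i) (vec (4 / 5) (3 / 5) (pathN 1) j) =
      lor (vec (24 / 25) (7 / 25) (pathN 0) i) (vec (24 / 25) (7 / 25) (pathN 0) j)) →
      hdist (vertex params_one i) (vertex params_one j) =
        hdist (vertex params_zero i) (vertex params_zero j) := by
    intro i j hij
    exact congrArg (fun x => Real.arcosh (-x)) hij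
  have key : ∀ a b c d, hexSusp.IsHinge a b c d →
      (Real.pi - dihedralAngle (vertex params_zero a) (vertex params_zero b) (vertex params_zero c)
        (vertex params_zero d)) * (hdist (vertex params_one a) (vertex params_one b) -
          hdist (vertex params_zero a) (vertex params_zero b)) ≤ 0 := by
    refine hexSusp_hinge_induction ?_ ?_ ?_ ?_ ?_ ?_ ?_ ?_ ?_ ?_ ?_
    · intro a b c d e
      rwa [dihedralAngle_swap (vertex params_zero a), hdist_comm (vertex params_one b),
        hdist_comm (vertex params_zero b)]
    · intro a b c d e
      rwa [dihedralAngle_isometry halfTurn lor_halfTurn det_halfTurn (vertex_hexFlip _ a)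
        (vertex_hexFlip _ b) (vertex_hexFlip _ c) (vertex_hexFlip _ d), hdist_hexFlip,
        hdist_hexFlip]
    · rw [hconst 0 2 (by simp [vec, lor]), sub_self, mul_zero]
    · rw [hconst 0 3 (by simp [vec, lor]), sub_self, mul_zero]
    · rw [hconst 0 4 (by simp [vec, lor]), sub_self, mul_zero]
    · exact mul_nonpos_of_nonneg_of_nonpos (by linarith [dihedralAngle_127_lt params_zero])
        (by linarith [hdist_path_one_two])
    · rw [dihedralAngle_132, sub_self, zero_mul]
    · exact mul_nonpos_of_nonpos_of_nonneg (by linarith [le_dihedralAngle_143 params_zero])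
        (by linarith [hdist_path_one_four])
    · rw [hconst 2 3 (by simp [vec, lor]), sub_self, mul_zero]
    · rw [hconst 3 4 (by simp [vec, lor]), sub_self, mul_zero]
    · rw [dihedralAngle_450, sub_self, zero_mul]
  refine mul_lt_mul_of_pos_left (Finset.sum_lt_sum (fun f hf => ?_) ⟨(1, 2, 7, 3), ?_, ?_⟩)
    (by norm_num)
  · simp only [OrientedTriangulation.hingesOnce, Finset.mem_filter, Finset.mem_univ,
      true_and] at hf
    rw [dihedralAngle_vertex_eq params_one params_zero _ _ _ _ hf.2]
    linarith [key _ _ _ _ hf.2]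
  · simp only [OrientedTriangulation.hingesOnce, Finset.mem_filter, Finset.mem_univ, true_and]
    exact ⟨by decide, by decide +kernel, by decide +kernel⟩
  · rw [dihedralAngle_vertex_eq params_one params_zero 1 2 7 3
      ⟨by decide +kernel, by decide +kernel⟩]
    exact mul_lt_mul_of_pos_left hdist_path_one_two
      (by linarith [dihedralAngle_127_lt params_zero])

end Curvature

section Area

open MeasureTheory

/-! ### The surface area -/

/-- The parameter domain of a geodesic triangle. -/
def simplex2 : Set (ℝ × ℝ) := {z | 0 ≤ z.1 ∧ 0 ≤ z.2 ∧ z.1 + z.2 ≤ 1}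

/-- The negative of the Gram determinant of three points of the hyperboloid, in terms of
the hyperbolic cosines `a`, `b`, `c` of their distances. -/
def gramDet (a b c : ℝ) : ℝ := 1 - a ^ 2 - b ^ 2 - c ^ 2 + 2 * a * b * c

/-- The negative of the Lorentz square of the convex combination of three points of
the hyperboloid, with the coefficients `1 - z.1 - z.2`, `z.1`, `z.2`. -/
def gramQuad (a b c : ℝ) (z : ℝ × ℝ) : ℝ :=
  (1 - z.1 - z.2) ^ 2 + z.1 ^ 2 + z.2 ^ 2 + 2 * (1 - z.1 - z.2) * z.1 * a +
    2 * (1 - z.1 - z.2) * z.2 * b + 2 * z.1 * z.2 * c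

lemma measurableSet_simplex2 : MeasurableSet simplex2 := by
  have : IsClosed simplex2 := by
    unfold simplex2
    exact (isClosed_le continuous_const continuous_fst).inter
      ((isClosed_le continuous_const continuous_snd).inter
        (isClosed_le (continuous_fst.add continuous_snd) continuous_const))
  exact this.measurableSet

lemma volume_simplex2_lt_top : volume simplex2 < ⊤ := by
  have : simplex2 ⊆ Set.Icc (0, 0) (1, 1) := by
    rintro ⟨x, y⟩ ⟨h1, h2, h3⟩
    simp only at h1 h2 h3
    exact ⟨⟨h1, h2⟩, ⟨by simp only; linarith, by simp only; linarith⟩⟩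
  exact (measure_mono this).trans_lt isCompact_Icc.measure_lt_top

lemma volume_simplex2_pos : 0 < volume.real simplex2 := by
  refine ENNReal.toReal_pos ?_ volume_simplex2_lt_top.ne
  have hsub : Set.Ioo (0 : ℝ) (1 / 2) ×ˢ Set.Ioo (0 : ℝ) (1 / 2) ⊆ simplex2 := by
    rintro ⟨x, y⟩ ⟨⟨h1, h2⟩, ⟨h3, h4⟩⟩
    exact ⟨h1.le, h3.le, by simp only at *; linarith⟩
  have hopen : IsOpen (Set.Ioo (0 : ℝ) (1 / 2) ×ˢ Set.Ioo (0 : ℝ) (1 / 2)) :=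
    isOpen_Ioo.prod isOpen_Ioo
  have := (hopen.measure_pos volume ⟨(1 / 4, 1 / 4), by norm_num⟩)
  exact (this.trans_le (measure_mono hsub)).ne'

lemma gramQuad_bounds {a b c M : ℝ} (ha : 1 ≤ a) (hb : 1 ≤ b) (hc : 1 ≤ c) (ha' : a ≤ M)
    (hb' : b ≤ M) (hc' : c ≤ M) {z : ℝ × ℝ} (hz : z ∈ simplex2) :
    1 ≤ gramQuad a b c z ∧ gramQuad a b c z ≤ M := by
  obtain ⟨s, t⟩ := z
  obtain ⟨h1, h2, h3⟩ := hz
  simp only at h1 h2 h3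
  have h4 : 0 ≤ 1 - s - t := by linarith
  have k1 := mul_nonneg h4 h1
  have k2 := mul_nonneg h4 h2
  have k3 := mul_nonneg h1 h2
  have e : gramQuad a b c (s, t) = 1 + 2 * ((1 - s - t) * s) * (a - 1) +
      2 * ((1 - s - t) * t) * (b - 1) + 2 * (s * t) * (c - 1) := by
    simp only [gramQuad]; ring
  have e' : gramQuad a b c (s, t) = M - ((1 - s - t) ^ 2 + s ^ 2 + t ^ 2) * (M - 1) -
      2 * ((1 - s - t) * s) * (M - a) - 2 * ((1 - s - t) * t) * (M - b) -
      2 * (s * t) * (M - c) := by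
    simp only [gramQuad]; ring
  constructor
  · rw [e]
    have := mul_nonneg k1 (sub_nonneg.2 ha)
    have := mul_nonneg k2 (sub_nonneg.2 hb)
    have := mul_nonneg k3 (sub_nonneg.2 hc)
    linarith
  · rw [e']
    have := mul_nonneg k1 (sub_nonneg.2 ha')
    have := mul_nonneg k2 (sub_nonneg.2 hb')
    have := mul_nonneg k3 (sub_nonneg.2 hc')
    have : 0 ≤ ((1 - s - t) ^ 2 + s ^ 2 + t ^ 2) * (M - 1) :=
      mul_nonneg (by positivity) (by linarith)
    linarith

/-- In homogeneous coordinates the density of the area is, up to a constant factor, the power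
`-3 / 2` of the negative of the Lorentz square. -/
lemma triArea_eq (u v w : H3) : triArea u v w = ∫ z in simplex2, Real.sqrt
    (gramDet (-lor u.1 v.1) (-lor u.1 w.1) (-lor v.1 w.1) /
      gramQuad (-lor u.1 v.1) (-lor u.1 w.1) (-lor v.1 w.1) z ^ 3) := by
  refine setIntegral_congr_fun measurableSet_simplex2 fun z hz => ?_
  have hN := (gramQuad_bounds (one_le_neg_lor u v) (one_le_neg_lor u w) (one_le_neg_lor v w)
    ((le_max_left _ _).trans (le_max_left _ _)) ((le_max_right _ _).trans (le_max_left _ _))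
    (le_max_right _ _) hz).1
  have hy : lor (u.1 + z.1 • (v.1 - u.1) + z.2 • (w.1 - u.1))
      (u.1 + z.1 • (v.1 - u.1) + z.2 • (w.1 - u.1)) =
      -gramQuad (-lor u.1 v.1) (-lor u.1 w.1) (-lor v.1 w.1) z := by
    simp only [lor_add_left, lor_add_right, lor_smul_left, lor_smul_right, lor_sub_left,
      lor_sub_right, u.2.1, v.2.1, w.2.1, lor_comm v.1 u.1, lor_comm w.1 u.1, lor_comm w.1 v.1,
      gramQuad]
    ring
  congr 1
  simp only [projMetric, hy]
  have hN0 : gramQuad (-lor u.1 v.1) (-lor u.1 w.1) (-lor v.1 w.1) z ≠ 0 := by linarith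
  set Q := gramQuad (-lor u.1 v.1) (-lor u.1 w.1) (-lor v.1 w.1) z with hQ
  simp only [lor_add_right, lor_smul_right, lor_sub_left, lor_sub_right, u.2.1, v.2.1,
    w.2.1, lor_comm v.1 u.1, lor_comm w.1 u.1, lor_comm w.1 v.1]
  simp only [gramQuad] at hQ
  rw [neg_neg, eq_div_iff (pow_ne_zero 3 hN0)]
  field_simp
  rw [hQ, gramDet]
  ring

lemma triArea_congr {u v w u' v' w' : H3} (h1 : lor u.1 v.1 = lor u'.1 v'.1)
    (h2 : lor u.1 w.1 = lor u'.1 w'.1) (h3 : lor v.1 w.1 = lor v'.1 w'.1) :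
    triArea u v w = triArea u' v' w' := by
  rw [triArea_eq, triArea_eq, h1, h2, h3]

/-- A small triangle has almost the area of the Euclidean triangle with the same vertices. -/
lemma triArea_bounds {u v w : H3} {M m a b c U L : ℝ} (hMm : M ^ 3 ≤ m ^ 2)
    (ha : -lor u.1 v.1 = a) (hb : -lor u.1 w.1 = b) (hc : -lor v.1 w.1 = c)
    (ha' : a ≤ M) (hb' : b ≤ M) (hc' : c ≤ M) (hU0 : 0 ≤ U)
    (hL : L ^ 2 ≤ gramDet a b c) (hU : gramDet a b c ≤ U ^ 2) :
    L / m * volume.real simplex2 ≤ triArea u v w ∧ triArea u v w ≤ U * volume.real simplex2 := by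
  have h1 : 1 ≤ a := ha ▸ one_le_neg_lor u v
  have h2 : 1 ≤ b := hb ▸ one_le_neg_lor u w
  have h3 : 1 ≤ c := hc ▸ one_le_neg_lor v w
  have hD : 0 ≤ gramDet a b c := (sq_nonneg L).trans hL
  have hpt : ∀ z ∈ simplex2, L / m ≤ Real.sqrt (gramDet a b c / gramQuad a b c z ^ 3) ∧
      Real.sqrt (gramDet a b c / gramQuad a b c z ^ 3) ≤ U := by
    intro z hz
    obtain ⟨k1, k2⟩ := gramQuad_bounds h1 h2 h3 ha' hb' hc' hz
    have k3 : 1 ≤ gramQuad a b c z ^ 3 := one_le_pow₀ k1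
    have k4 : gramQuad a b c z ^ 3 ≤ m ^ 2 :=
      (pow_le_pow_left₀ (by linarith) k2 3).trans hMm
    constructor
    · refine Real.le_sqrt_of_sq_le ?_
      rw [div_pow]
      exact div_le_div₀ hD hL (by linarith) k4
    · refine Real.sqrt_le_iff.2 ⟨hU0, ?_⟩
      rw [div_le_iff₀ (by linarith)]
      nlinarith [sq_nonneg U]
  have hmeas : Measurable fun z : ℝ × ℝ => Real.sqrt (gramDet a b c / gramQuad a b c z ^ 3) := by
    unfold gramQuad; fun_prop
  have hint : IntegrableOn (fun z : ℝ × ℝ => Real.sqrt (gramDet a b c / gramQuad a b c z ^ 3))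
      simplex2 := by
    refine Measure.integrableOn_of_bounded (M := U) volume_simplex2_lt_top.ne
      hmeas.aestronglyMeasurable ?_
    refine (ae_restrict_iff' measurableSet_simplex2).2 (Filter.Eventually.of_forall fun z hz => ?_)
    rw [Real.norm_of_nonneg (Real.sqrt_nonneg _)]
    exact (hpt z hz).2
  have hcst : ∀ r : ℝ, IntegrableOn (fun _ : ℝ × ℝ => r) simplex2 := fun r =>
    integrableOn_const volume_simplex2_lt_top.ne
  rw [triArea_eq, ha, hb, hc]
  constructor
  · have := setIntegral_mono_on (hcst (L / m)) hint measurableSet_simplex2 fun z hz => (hpt z hz).1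
    rwa [setIntegral_const, smul_eq_mul, mul_comm] at this
  · have := setIntegral_mono_on hint (hcst U) measurableSet_simplex2 fun z hz => (hpt z hz).2
    rwa [setIntegral_const, smul_eq_mul, mul_comm] at this

variable {C S N : ℝ}

lemma triArea_hexFlip (h : Params C S N) (i j k : Fin 8) :
    triArea (vertex h (hexFlip i)) (vertex h (hexFlip j)) (vertex h (hexFlip k)) =
      triArea (vertex h i) (vertex h j) (vertex h k) := by
  apply triArea_congr <;> rw [vertex_hexFlip, vertex_hexFlip, lor_halfTurn]

lemma surfaceArea_vertex (h : Params C S N) : surfaceArea hexSusp (vertex h) =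
    2 * (triArea (vertex h 0) (vertex h 2) (vertex h 3) +
      triArea (vertex h 0) (vertex h 3) (vertex h 4) +
      triArea (vertex h 0) (vertex h 4) (vertex h 5) +
      triArea (vertex h 1) (vertex h 3) (vertex h 2) +
      triArea (vertex h 1) (vertex h 4) (vertex h 3) +
      triArea (vertex h 1) (vertex h 5) (vertex h 4)) := by
  have e1 := triArea_hexFlip h 0 2 3
  have e2 := triArea_hexFlip h 0 3 4
  have e3 := triArea_hexFlip h 0 4 5
  have e4 := triArea_hexFlip h 1 3 2
  have e5 := triArea_hexFlip h 1 4 3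
  have e6 := triArea_hexFlip h 1 5 4
  simp [hexFlip] at e1 e2 e3 e4 e5 e6
  rw [surfaceArea, hexSusp_facesOnce, hexFaces]
  iterate 11 rw [Finset.sum_insert (by decide +kernel)]
  rw [Finset.sum_singleton]
  simp only [e1, e2, e3, e4, e5, e6]
  ring

/-- The faces `0 2 3` and `0 3 4` lie on a rotating tetrahedron and keep their area. The other four
are compared by `triArea_bounds`: their Gram determinants differ enough for its error to be
harmless. -/
lemma surfaceArea_path_lt : surfaceArea hexSusp (path 1) < surfaceArea hexSusp (path 0) := by
  rw [path_zero, path_one, surfaceArea_vertex, surfaceArea_vertex]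
  have hI := volume_simplex2_pos
  have k0 := pathN_zero_bounds
  have k1 := pathN_one_bounds
  have n0 : pathN 0 ^ 2 = 1 / ((24 / 25) ^ 2 - (80 / 1601) ^ 2) := by
    rw [eq_div_iff (by norm_num)]; exact params_zero.N_sq
  have n1 : pathN 1 ^ 2 = 1 / ((4 / 5) ^ 2 - (80 / 1601) ^ 2) := by
    rw [eq_div_iff (by norm_num)]; exact params_one.N_sq
  have c1 : triArea (vertex params_one 0) (vertex params_one 2) (vertex params_one 3) =
      triArea (vertex params_zero 0) (vertex params_zero 2) (vertex params_zero 3) := by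
    apply triArea_congr <;> simp [vertex, vec, lor]
  have c2 : triArea (vertex params_one 0) (vertex params_one 3) (vertex params_one 4) =
      triArea (vertex params_zero 0) (vertex params_zero 3) (vertex params_zero 4) := by
    apply triArea_congr <;> simp [vertex, vec, lor]
  -- Only the bounds by `L` are used for `path 0`, and only those by `U` for `path 1`; the other
  -- bound is a trivial one.
  have a1 := (triArea_bounds (u := vertex params_zero 0) (v := vertex params_zero 4)
    (w := vertex params_zero 5) (M := 1.0228) (m := 1.035) (L := 0.00714) (U := 1) (by norm_num)
    rfl rfl rfl ?_ ?_ ?_ (by norm_num) ?_ ?_).1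
  have a2 := (triArea_bounds (u := vertex params_zero 1) (v := vertex params_zero 3)
    (w := vertex params_zero 2) (M := 1.0228) (m := 1.035) (L := 0.01324) (U := 1) (by norm_num)
    rfl rfl rfl ?_ ?_ ?_ (by norm_num) ?_ ?_).1
  have a3 := (triArea_bounds (u := vertex params_zero 1) (v := vertex params_zero 4)
    (w := vertex params_zero 3) (M := 1.0228) (m := 1.035) (L := 0.00103) (U := 1) (by norm_num)
    rfl rfl rfl ?_ ?_ ?_ (by norm_num) ?_ ?_).1
  have a4 := (triArea_bounds (u := vertex params_zero 1) (v := vertex params_zero 5)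
    (w := vertex params_zero 4) (M := 1.0228) (m := 1.035) (L := 0.00146) (U := 1) (by norm_num)
    rfl rfl rfl ?_ ?_ ?_ (by norm_num) ?_ ?_).1
  have b1 := (triArea_bounds (u := vertex params_one 0) (v := vertex params_one 4)
    (w := vertex params_one 5) (M := 2) (m := 3) (L := 0) (U := 0.00038) (by norm_num)
    rfl rfl rfl ?_ ?_ ?_ (by norm_num) ?_ ?_).2
  have b2 := (triArea_bounds (u := vertex params_one 1) (v := vertex params_one 3)
    (w := vertex params_one 2) (M := 2) (m := 3) (L := 0) (U := 0.01161) (by norm_num)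
    rfl rfl rfl ?_ ?_ ?_ (by norm_num) ?_ ?_).2
  have b3 := (triArea_bounds (u := vertex params_one 1) (v := vertex params_one 4)
    (w := vertex params_one 3) (M := 2) (m := 3) (L := 0) (U := 0.00266) (by norm_num)
    rfl rfl rfl ?_ ?_ ?_ (by norm_num) ?_ ?_).2
  have b4 := (triArea_bounds (u := vertex params_one 1) (v := vertex params_one 5)
    (w := vertex params_one 4) (M := 2) (m := 3) (L := 0) (U := 0.00592) (by norm_num)
    rfl rfl rfl ?_ ?_ ?_ (by norm_num) ?_ ?_).2
  · rw [c1, c2]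
    norm_num at a1 a2 a3 a4 b1 b2 b3 b4 ⊢
    linarith
  all_goals simp [vertex, vec, lor, gramDet]
  -- Every remaining bound is linear in `pathN 0`, `pathN 1` and their squares.
  all_goals clear c1 c2
  all_goals first
    | (norm_num; done)
    | linarith

end Area

end HypPoly

end

theorem theorem1 :
    ∃ (n : ℕ) (K : HypPoly.OrientedTriangulation n) (P : unitInterval → Fin n → HypPoly.H3),
      Continuous P ∧
      (∀ t, HypPoly.IsEmbeddedSphere K (P t) ∧ ¬ HypPoly.ConvexSurface K (P t)) ∧
      (∀ t, t ≠ 0 → ¬ HypPoly.Congruent (P 0) (P t)) ∧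
      (∀ t a b c d, K.IsHinge a b c d →
        HypPoly.dihedralAngle (P t a) (P t b) (P t c) (P t d) =
          HypPoly.dihedralAngle (P 0 a) (P 0 b) (P 0 c) (P 0 d)) ∧
      (∃ s t, HypPoly.surfaceArea K (P s) ≠ HypPoly.surfaceArea K (P t)) ∧
      (∃ s t, HypPoly.totalMeanCurvature K (P s) ≠ HypPoly.totalMeanCurvature K (P t)) ∧
      (∃ v s t, HypPoly.gaussCurvature K (P s) v ≠ HypPoly.gaussCurvature K (P t) v) := by
  refine ⟨8, HypPoly.hexSusp, HypPoly.path, HypPoly.continuous_path,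
    fun t => ⟨HypPoly.vertex_isEmbeddedSphere _, HypPoly.vertex_not_convexSurface _⟩,
    fun t ht => HypPoly.path_not_congruent ht.symm,
    fun t => HypPoly.dihedralAngle_vertex_eq _ _, ⟨1, 0, HypPoly.surfaceArea_path_lt.ne⟩,
    ⟨1, 0, HypPoly.totalMeanCurvature_path_lt.ne⟩, ⟨0, 0, 1, HypPoly.gaussCurvature_path_ne⟩⟩
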